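/- Conventions. $D^2\subset\mathbb C$ is the closed unit disc with polar coordinates $(r,\theta)$, area form $\omega=2r\,dr\wedge d\theta$ and primitive $\lambda=r^2\,d\theta$; $S^1=\mathbb R/2\pi\mathbb Z$, and $D^2_\delta$ is the disc of radius $\delta$. For a smooth $2\pi$-periodic Hamiltonian $H_s\colon D^2\to\mathbb R$, $s\in S^1$ (smooth on $S^1\times D^2$ up to the boundary), the vector field $X_s$ is defined by $\omega(X_s,\cdot)=dH_s$, and the diffeomorphism generated by $H_s$ is the time-$2\pi$ map of the isotopy of $D^2$ given by $X_s$, starting at the identity. An area-preserving diffeomorphism $\psi$ of $(D^2,\omega)$ *embeds into a Reeb flow on $S^3$* if there are a contact form $\alpha$ on $S^3$, a smoothly embedded closed disc $\Sigma\subset S^3$ and a homeomorphism $j\colon D^2\to\Sigma$, restricting to a diffeomorphism $\operatorname{Int}D^2\to\operatorname{Int}\Sigma$ with $j^*d\alpha=\omega$ there, such that - $\Sigma$ is a global surface of section for the Reeb flow of $\alpha$: $\partial\Sigma$ is a periodic Reeb orbit, $\operatorname{Int}\Sigma$ is transverse to the Reeb vector field, and the orbit through any point of $S^3\setminus\partial\Sigma$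 meets $\operatorname{Int}\Sigma$ in forward and in backward time; - the Poincaré return map $P\colon\operatorname{Int}\Sigma\to\operatorname{Int}\Sigma$ (first intersection in forward time) satisfies $P\circ j=j\circ\psi$ on $\operatorname{Int}D^2$. **Theorem.** Let $\psi\colon D^2\to D^2$ be an area-preserving diffeomorphism generated by a $2\pi$-periodic Hamiltonian function $H_s$ with $H_s|_{\partial D^2}\equiv h\in\mathbb N$ for all $s$, and suppose that $H_s\,ds+\lambda$ is a positive contact form on $S^1\times D^2$, i.e. $H_s+\lambda(X_s)>0$ everywhere on $S^1\times D^2$. Let $0<\varepsilon\le 1$, let $B=S^1$ and set $$\Phi\colon B\times\bigl(\operatorname{Int}(D^2_{\sqrt\varepsilon})\setminus\{0\}\bigr)\to S^1\times D^2,\qquad \Phi(b,\rho e^{i\vartheta})=\bigl(s=\vartheta;\ r=1-\rho^2,\ \theta=b-h\vartheta\bigr).$$ Consider the function $$f(b,\rho e^{i\vartheta})=\frac{(H_s\circ\Phi)(b,\rho e^{i\vartheta})-h(1-\rho^2)^2}{\rho^2}$$ on $B\times(\operatorname{Int}(D^2_{\sqrt\varepsilon})\setminus\{0\})$. Suppose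 that $f$ extends continuously over the binding $B\times\{0\}$, and that the lift $\tilde f(b,\rho,\vartheta)=f(b,\rho e^{i\vartheta})$ of the extended function to $B\times[0,\sqrt\varepsilon)\times S^1$ is smooth and has, along $B\times\{0\}\times S^1$, the same $\infty$-jet as the lift $\tilde g(b,\rho,\vartheta)=g(b,\rho e^{i\vartheta})$ of some smooth function $g$ on $B\times\operatorname{Int}(D^2_{\sqrt\varepsilon})$. Then $\psi$ embeds into a Reeb flow on $S^3$. -/

import Mathlib

open Set Function Metric
open scoped ContDiff

noncomputable section

/-! ### The closed unit disc with its standard area form -/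

/-- The closed unit disc `D²` in `ℂ = ℝ²`. -/
def disc : Set ℂ := closedBall 0 1

/-- The area form `ω = 2 r dr ∧ dθ = 2 dx ∧ dy`. -/
def areaForm (u v : ℂ) : ℝ := 2 * (u.re * v.im - u.im * v.re)

/-- The primitive `λ = r² dθ = x dy - y dx` of the area form, evaluated at `z` on `v`. -/
def liouvilleForm (z v : ℂ) : ℝ := z.re * v.im - z.im * v.re

/-- `ψ` restricts to a diffeomorphism of the closed disc, smooth up to the boundary together with
its inverse, and `ψ^* ω = ω`. -/
structure IsAreaPreservingDiffeo (ψ : ℂ → ℂ) : Prop where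
  smooth : ContDiffOn ℝ ∞ ψ disc
  mapsTo : MapsTo ψ disc disc
  smooth_inverse : ∃ χ : ℂ → ℂ, ContDiffOn ℝ ∞ χ disc ∧ MapsTo χ disc disc ∧ InvOn χ ψ disc disc
  area : ∀ z ∈ disc, ∀ u v : ℂ,
    areaForm (fderivWithin ℝ ψ disc z u) (fderivWithin ℝ ψ disc z v) = areaForm u v

/-! ### Time-dependent Hamiltonians on the disc -/

/-- The differential at `z` of the function `H_s : D² → ℝ`, for fixed `s`. -/
def spatialDeriv (H : ℝ → ℂ → ℝ) (s : ℝ) (z : ℂ) : ℂ →L[ℝ] ℝ := fderivWithin ℝ (H s) disc z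

/-- The Hamiltonian vector field `X_s`, determined by `ω(X_s, ·) = dH_s`
(see `areaForm_hamiltonianField`). -/
def hamiltonianField (H : ℝ → ℂ → ℝ) (s : ℝ) (z : ℂ) : ℂ :=
  ⟨spatialDeriv H s z Complex.I / 2, -(spatialDeriv H s z 1) / 2⟩

theorem areaForm_hamiltonianField (H : ℝ → ℂ → ℝ) (s : ℝ) (z v : ℂ) :
    areaForm (hamiltonianField H s z) v = spatialDeriv H s z v := by
  have hv : v = v.re • (1 : ℂ) + v.im • Complex.I := by
    apply Complex.ext <;> simp
  conv_rhs => rw [hv, map_add, map_smul, map_smul]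
  simp only [areaForm, hamiltonianField, smul_eq_mul]
  ring

/-- `H` is a smooth Hamiltonian function on `S¹ × D²`, `S¹ = ℝ / 2πℤ`, smooth up to the boundary. -/
structure IsPeriodicHamiltonian (H : ℝ → ℂ → ℝ) : Prop where
  smooth : ContDiffOn ℝ ∞ (uncurry H) (univ ×ˢ disc)
  periodic : ∀ s : ℝ, ∀ z ∈ disc, H (s + 2 * Real.pi) z = H s z

/-- `ψ` is the time-`2π` map of the isotopy `φ_s` of `D²` with `φ_0 = id` and
`dφ_s/ds = X_s ∘ φ_s`. -/
def IsGeneratedBy (ψ : ℂ → ℂ) (H : ℝ → ℂ → ℝ) : Prop :=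
  ∃ φ : ℝ → ℂ → ℂ,
    (∀ z ∈ disc, φ 0 z = z) ∧
    (∀ s : ℝ, ∀ z ∈ disc, φ s z ∈ disc ∧
      HasDerivAt (fun t => φ t z) (hamiltonianField H s (φ s z)) s) ∧
    ∀ z ∈ disc, ψ z = φ (2 * Real.pi) z

/-- The condition `H_s + λ(X_s) > 0` on `S¹ × D²`, which says that `H_s ds + λ` is a positive
contact form there. -/
def ContactCondition (H : ℝ → ℂ → ℝ) : Prop :=
  ∀ s : ℝ, ∀ z ∈ disc, 0 < H s z + liouvilleForm z (hamiltonianField H s z)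

/-! ### Coordinates near the binding -/

/-- The map `Φ`, `(b; ρ, ϑ) ↦ (s = ϑ; r = 1 - ρ², θ = b - h ϑ)`, with values in pairs
`(s, r e^{iθ})`. -/
def bindingMap (h : ℕ) (b ρ ϑ : ℝ) : ℝ × ℂ :=
  (ϑ, ((1 - ρ ^ 2 : ℝ) : ℂ) * Complex.exp (((b - h * ϑ : ℝ) : ℂ) * Complex.I))

/-- The lift `(b, ρ, ϑ) ↦ u(b, ρ e^{iϑ})` of a function `u` to polar coordinates. -/
def polarLift (u : ℝ → ℂ → ℝ) (p : ℝ × ℝ × ℝ) : ℝ :=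
  u p.1 ((p.2.1 : ℂ) * Complex.exp ((p.2.2 : ℂ) * Complex.I))

/-- The domain `B × [0, δ) × S¹` of the lifted functions (with angles taken in `ℝ`). -/
def polarDomain (δ : ℝ) : Set (ℝ × ℝ × ℝ) := univ ×ˢ (Ico 0 δ ×ˢ univ)

/-! ### Contact forms and Reeb flows on the 3-sphere -/

/-- The unit sphere `S³ ⊂ ℂ²`. -/
def sphereThree : Set (ℂ × ℂ) := {x | ‖x.1‖ ^ 2 + ‖x.2‖ ^ 2 = 1}

/-- `v` is tangent to the sphere at `x ∈ S³`. -/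
def IsTangent (x v : ℂ × ℂ) : Prop := inner ℝ x.1 v.1 + inner ℝ x.2 v.2 = 0

/-- The exterior derivative `dα_x(u, v)` of a 1-form on `ℂ² = ℝ⁴`. On vectors tangent to `S³`
it depends only on the restriction of `α` to `S³`. -/
def extD (α : ℂ × ℂ → (ℂ × ℂ) →L[ℝ] ℝ) (x u v : ℂ × ℂ) : ℝ :=
  fderiv ℝ α x u v - fderiv ℝ α x v u

/-- `α` is a 1-form, defined and smooth near `S³`, that restricts to a contact form on `S³`:
`α ∧ dα` vanishes nowhere on `S³`. (Every smooth 1-form on `S³` is such a restriction.) -/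
structure IsContactForm (α : ℂ × ℂ → (ℂ × ℂ) →L[ℝ] ℝ) : Prop where
  smooth : ∀ x ∈ sphereThree, ContDiffAt ℝ ∞ α x
  nondegenerate : ∀ x ∈ sphereThree, ∀ u v w : ℂ × ℂ,
    IsTangent x u → IsTangent x v → IsTangent x w → LinearIndependent ℝ ![u, v, w] →
      α x u * extD α x v w + α x v * extD α x w u + α x w * extD α x u v ≠ 0

/-- `v` is the value at `x ∈ S³` of the Reeb vector field of `α|_{S³}`. -/
def IsReebVector (α : ℂ × ℂ → (ℂ × ℂ) →L[ℝ] ℝ) (x v : ℂ × ℂ) : Prop :=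
  IsTangent x v ∧ α x v = 1 ∧ ∀ w, IsTangent x w → extD α x v w = 0

/-- `Fl` is the (global) flow on `S³` of the Reeb vector field of `α|_{S³}`. -/
def IsReebFlow (α : ℂ × ℂ → (ℂ × ℂ) →L[ℝ] ℝ) (Fl : ℝ → ℂ × ℂ → ℂ × ℂ) : Prop :=
  ∀ x ∈ sphereThree, Fl 0 x = x ∧ ∀ t : ℝ, Fl t x ∈ sphereThree ∧
    ∃ v, IsReebVector α (Fl t x) v ∧ HasDerivAt (fun τ => Fl τ x) v t

/-- `ι` is an embedding of the closed disc into `S³`, smooth up to the boundary. -/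
structure IsSmoothDiscEmbedding (ι : ℂ → ℂ × ℂ) : Prop where
  smooth : ContDiffOn ℝ ∞ ι disc
  mapsTo : MapsTo ι disc sphereThree
  injOn : InjOn ι disc
  immersion : ∀ z ∈ disc, Injective (fderivWithin ℝ ι disc z)

/-- The smooth disc `ι(D²)` is a global surface of section for the Reeb flow `Fl` of `α`. -/
structure IsGlobalSurfaceOfSection (α : ℂ × ℂ → (ℂ × ℂ) →L[ℝ] ℝ)
    (Fl : ℝ → ℂ × ℂ → ℂ × ℂ) (ι : ℂ → ℂ × ℂ) : Prop where
  embedding : IsSmoothDiscEmbedding ι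
  boundary_periodic : ∃ p ∈ ι '' sphere 0 1, ∃ T : ℝ, 0 < T ∧ Fl T p = p ∧
    range (fun t : ℝ => Fl t p) = ι '' sphere 0 1
  transverse : ∀ z ∈ ball (0 : ℂ) 1, ∀ v, IsReebVector α (ι z) v →
    v ∉ range (fderivWithin ℝ ι disc z)
  forward : ∀ p ∈ sphereThree \ ι '' sphere 0 1, ∃ t : ℝ, 0 < t ∧ Fl t p ∈ ι '' ball 0 1
  backward : ∀ p ∈ sphereThree \ ι '' sphere 0 1, ∃ t : ℝ, t < 0 ∧ Fl t p ∈ ι '' ball 0 1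

/-- `q` is the image of `p` under the Poincaré return map of the flow `Fl` on `S`, that is,
the first point in forward time at which the orbit of `p` meets `S`. -/
def IsFirstReturn (Fl : ℝ → ℂ × ℂ → ℂ × ℂ) (S : Set (ℂ × ℂ)) (p q : ℂ × ℂ) : Prop :=
  ∃ T : ℝ, 0 < T ∧ Fl T p = q ∧ q ∈ S ∧ ∀ t ∈ Ioo 0 T, Fl t p ∉ S

/-- The map `ψ` of the disc embeds into a Reeb flow on `S³`: there are a contact form `α` on `S³`
and a smooth disc `Σ = ι(D²)` that is a global surface of section for its Reeb flow, and a
homeomorphism `j : D² → Σ`, a diffeomorphism between the interiors carrying the area form `ω`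
to `dα`, such that the return map on the interior of `Σ` is `ψ` (under the identification `j`). -/
def EmbedsIntoReebFlow (ψ : ℂ → ℂ) : Prop :=
  ∃ (α : ℂ × ℂ → (ℂ × ℂ) →L[ℝ] ℝ) (Fl : ℝ → ℂ × ℂ → ℂ × ℂ) (ι j : ℂ → ℂ × ℂ),
    IsContactForm α ∧ IsReebFlow α Fl ∧ IsGlobalSurfaceOfSection α Fl ι ∧
    ContinuousOn j disc ∧ InjOn j disc ∧
    j '' ball 0 1 = ι '' ball 0 1 ∧ j '' sphere 0 1 = ι '' sphere 0 1 ∧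
    ContDiffOn ℝ ∞ j (ball 0 1) ∧
    (∀ z ∈ ball (0 : ℂ) 1, Injective (fderiv ℝ j z)) ∧
    (∀ z ∈ ball (0 : ℂ) 1, ∀ u v : ℂ,
      extD α (j z) (fderiv ℝ j z u) (fderiv ℝ j z v) = areaForm u v) ∧
    ∀ z ∈ ball (0 : ℂ) 1, IsFirstReturn Fl (ι '' ball 0 1) (j z) (j (ψ z))

end

noncomputable section

/-! View `S³` as an open book with binding `{x₂ = 0}` and disc pages. The map `openBookMap`, `(s, z)
↦ (z e^{ihs}, √(1-|z|²) e^{is})`, covers the complement of the binding and pulls `r₁² dθ₁` back to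
`λ + h|z|² ds` and `r₂² dθ₂` back to `(1-|z|²) ds`. Hence `α = r₁² dθ₁ + F r₂² dθ₂` pulls back to
the given contact form `H_s ds + λ` exactly when `F = (H_s - h|z|²)/(1-|z|²)`. With this choice
(`coeffForm_openBookTangent`, `extD_openBookTangent`) the Reeb field off the binding is a positive
multiple of `∂_s + X_s`. Each page `s = const` is therefore crossed positively, `dα` restricts to
`ω` on the page `s = 0`, and the return map of that page is the time-`2π` map `ψ`, up to a change of
time (`exists_lift`, `eq_isotopy_of_hasDerivAt`, `isFirstReturn`).

What remains is the binding. Write `r = |x₁| = 1 - ρ²` near it. Since `|x₂|² = (1-r)(1+r)`, the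
coordinate `ρ` of `Φ` is `|x₂|/√(1+r)`, and `F = f/(1+r)` with `f` evaluated at `x₂/√(1+r)`
(`sphereCoeff_eq_near_binding`). So `F` is smooth on `S³` once `f` is smooth on the solid torus. The
jet hypothesis gives this: `f - g` is flat along the binding in polar coordinates. Returning to
Cartesian coordinates costs only negative powers of `ρ`, which flatness absorbs
(`contDiffOn_uncurry_of_polarLift_flat`).

Along the binding `α ∧ dα` is a positive multiple of `F dθ₁ ∧ dx₂ ∧ dy₂`, and the limit of the
defining quotient gives `F = f/2 = H + λ(X) > 0` (`extension_apply_zero`). The contact condition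
thus holds everywhere (`isContactForm`), and the binding is a Reeb orbit. Because `S³` is
parallelizable, the Reeb field has an explicit smooth formula in a global frame, and its flow is
obtained from a compactly supported extension to `ℂ²` (`exists_reebFlow`). -/

/-! ### Completeness of bounded Lipschitz vector fields -/

/-- A bounded globally Lipschitz vector field on a Banach space is complete. -/
theorem exists_integralCurve_of_lipschitz_bounded {E : Type*} [NormedAddCommGroup E]
    [NormedSpace ℝ E] [CompleteSpace E] {W : E → E} {K L : NNReal} (hK : LipschitzWith K W)
    (hL : ∀ x, ‖W x‖ ≤ L) (x : E) :
    ∃ γ : ℝ → E, γ 0 = x ∧ ∀ t, HasDerivAt γ (W (γ t)) t := by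
  have key : ∀ a : NNReal, 0 < a → ∃ γ : ℝ → E, γ 0 = x ∧
      ∀ t ∈ Ioo (-(a : ℝ)) a, HasDerivAt γ (W (γ t)) t := by
    intro a ha
    have ha' : (0 : ℝ) < a := by exact_mod_cast ha
    have h0 : (0 : ℝ) ∈ Icc (-(a : ℝ)) a := ⟨by linarith, ha'.le⟩
    -- A curve of speed at most `L` stays within distance `L * a` during time `a`, so the
    -- Picard–Lindelöf radius imposes no limit on `a`.
    have hpl : IsPicardLindelof (fun _ => W) (⟨0, h0⟩ : Icc (-(a : ℝ)) a) x (L * a) 0 L K :=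
      IsPicardLindelof.of_time_independent (fun y _ => hL y) hK.lipschitzOnWith (by simp)
    obtain ⟨γ, hγ0, hγ⟩ := hpl.exists_eq_forall_mem_Icc_hasDerivWithinAt₀
    exact ⟨γ, hγ0, fun t ht => (hγ t (Ioo_subset_Icc_self ht)).hasDerivAt
      (Icc_mem_nhds ht.1 ht.2)⟩
  choose! γ hγ0 hγ using key
  have agree : ∀ a b : NNReal, 0 < a → a ≤ b →
      EqOn (γ a) (γ b) (Ioo (-(a : ℝ)) a) := by
    intro a b ha hab
    have ha' : (0 : ℝ) < a := by exact_mod_cast ha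
    have hab' : (a : ℝ) ≤ b := by exact_mod_cast hab
    refine ODE_solution_unique_of_mem_Ioo (v := fun _ => W) (s := fun _ => univ) (t₀ := 0)
      (fun _ _ => hK.lipschitzOnWith) ⟨by linarith, ha'⟩
      (fun t ht => ⟨hγ a ha t ht, mem_univ _⟩) (fun t ht => ⟨hγ b (ha.trans_le hab) t
        ⟨by linarith [ht.1], by linarith [ht.2]⟩, mem_univ _⟩) ?_
    rw [hγ0 a ha, hγ0 b (ha.trans_le hab)]
  -- At time `t` the solution on `(-(|t|+1), |t|+1)` is used; by `agree` these local solutions glue.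
  refine ⟨fun t => γ (‖t‖₊ + 1) t, hγ0 _ (by positivity), fun t => ?_⟩
  have hmem : t ∈ Ioo (-((‖t‖₊ + 1 : NNReal) : ℝ)) ((‖t‖₊ + 1 : NNReal) : ℝ) := by
    rw [mem_Ioo, ← abs_lt]; simp
  refine (hγ (‖t‖₊ + 1) (by positivity) t hmem).congr_of_eventuallyEq ?_
  filter_upwards [Ioo_mem_nhds hmem.1 hmem.2] with τ hτ
  have hτ' : τ ∈ Ioo (-((‖τ‖₊ + 1 : NNReal) : ℝ)) ((‖τ‖₊ + 1 : NNReal) : ℝ) := by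
    rw [mem_Ioo, ← abs_lt]; simp
  rcases le_total (‖τ‖₊ + 1) (‖t‖₊ + 1) with hle | hle
  · exact agree _ _ (by positivity) hle hτ'
  · exact (agree _ _ (by positivity) hle hτ).symm

/-! ### Functions flat along the axis in polar coordinates -/

theorem contDiffAt_complex_arg {z : ℂ} (hz : z ∈ Complex.slitPlane) {n : WithTop ℕ∞} :
    ContDiffAt ℝ n Complex.arg z := by
  have h1 : ContDiffAt ℝ n Complex.log z := (Complex.contDiffAt_log hz).restrict_scalars ℝ
  have h2 := Complex.imCLM.contDiff.contDiffAt.comp z h1 (n := n)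
  refine h2.congr_of_eventuallyEq (Filter.Eventually.of_forall fun w => ?_)
  simp [Complex.log_im]

theorem uniqueDiffOn_polarDomain (δ : ℝ) : UniqueDiffOn ℝ (polarDomain δ) :=
  uniqueDiffOn_univ.prod ((uniqueDiffOn_Ico 0 δ).prod uniqueDiffOn_univ)

/-- A smooth function on `ℝ × [0, δ) × ℝ` whose jets vanish along `ρ = 0` has derivatives that
decay faster than any power of `ρ`. -/
theorem norm_iteratedFDerivWithin_le_pow_of_flat {δ : ℝ} {V : ℝ × ℝ × ℝ → ℝ}
    (hV : ContDiffOn ℝ ∞ V (polarDomain δ))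
    (hflat : ∀ n b ϑ, iteratedFDerivWithin ℝ n V (polarDomain δ) (b, 0, ϑ) = 0)
    (R : ℝ) {r : ℝ} (hr : r < δ) (N n : ℕ) :
    ∃ C, 0 ≤ C ∧ ∀ b ∈ Icc (-R) R, ∀ ρ ∈ Icc 0 r, ∀ ϑ ∈ Icc (-R) R,
      ‖iteratedFDerivWithin ℝ n V (polarDomain δ) (b, ρ, ϑ)‖ ≤ C * ρ ^ N := by
  induction N generalizing n with
  | zero =>
    have hc : IsCompact (Icc (-R) R ×ˢ (Icc 0 r ×ˢ Icc (-R) R)) :=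
      isCompact_Icc.prod (isCompact_Icc.prod isCompact_Icc)
    obtain ⟨C, hC⟩ := hc.exists_bound_of_continuousOn
      ((hV.continuousOn_iteratedFDerivWithin (m := n) (by exact_mod_cast le_top)
        (uniqueDiffOn_polarDomain δ)).mono
      (prod_mono (subset_univ _) (prod_mono (fun x hx => ⟨hx.1, hx.2.trans_lt hr⟩)
        (subset_univ _))))
    refine ⟨max C 0, le_max_right _ _, fun b hb ρ hρ ϑ hϑ => ?_⟩
    rw [pow_zero, mul_one]
    exact (hC (b, ρ, ϑ) ⟨hb, hρ, hϑ⟩).trans (le_max_left _ _)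
  | succ N ih =>
    -- The mean value inequality on the radial segment from `(b, 0, ϑ)`, where the `n`-th derivative
    -- vanishes, gains one power of `ρ` at the cost of one more derivative.
    obtain ⟨C, hC0, hC⟩ := ih (n + 1)
    refine ⟨C, hC0, fun b hb ρ hρ ϑ hϑ => ?_⟩
    set S : Set (ℝ × ℝ × ℝ) := {b} ×ˢ (Icc 0 ρ ×ˢ {ϑ}) with hS
    have hSconv : Convex ℝ S := (convex_singleton b).prod ((convex_Icc 0 ρ).prod
      (convex_singleton ϑ))
    have hSsub : S ⊆ polarDomain δ := by
      rintro ⟨b', ρ', ϑ'⟩ ⟨-, h2, -⟩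
      exact ⟨mem_univ _, ⟨h2.1, (h2.2.trans hρ.2).trans_lt hr⟩, mem_univ _⟩
    have hd := hV.differentiableOn_iteratedFDerivWithin (m := n)
      (by exact_mod_cast ENat.natCast_lt_top n) (uniqueDiffOn_polarDomain δ)
    have := hSconv.norm_image_sub_le_of_norm_hasFDerivWithin_le
      (f := iteratedFDerivWithin ℝ n V (polarDomain δ))
      (f' := fderivWithin ℝ (iteratedFDerivWithin ℝ n V (polarDomain δ)) (polarDomain δ))
      (C := C * ρ ^ N) (x := (b, 0, ϑ)) (y := (b, ρ, ϑ))
      (fun x hx => ((hd x (hSsub hx)).hasFDerivWithinAt).mono hSsub)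
      (by
        rintro ⟨b', ρ', ϑ'⟩ ⟨h1, h2, h3⟩
        simp only [mem_singleton_iff] at h1 h3
        subst h1 h3
        rw [norm_fderivWithin_iteratedFDerivWithin]
        refine (hC _ hb _ ⟨h2.1, h2.2.trans hρ.2⟩ _ hϑ).trans ?_
        have := h2.1
        have := h2.2
        dsimp only at *
        gcongr)
      ⟨rfl, ⟨le_rfl, hρ.1⟩, rfl⟩ ⟨rfl, ⟨hρ.1, le_rfl⟩, rfl⟩
    rw [hflat, sub_zero] at this
    refine this.trans (le_of_eq ?_)
    have : ‖((b, ρ, ϑ) : ℝ × ℝ × ℝ) - (b, 0, ϑ)‖ = ρ := by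
      simp [Prod.norm_def, abs_of_nonneg hρ.1, hρ.1]
    rw [this]; ring

/-- Polar coordinates `(b, η) ↦ (b, |η|, arg η)`. -/
def polarChart (p : ℝ × ℂ) : ℝ × ℝ × ℝ := (p.1, ‖p.2‖, Complex.arg p.2)

theorem contDiffAt_polarChart {p : ℝ × ℂ} (hp : p.2 ∈ Complex.slitPlane) {n : WithTop ℕ∞} :
    ContDiffAt ℝ n polarChart p := by
  have h0 : p.2 ≠ 0 := Complex.slitPlane_ne_zero hp
  exact contDiffAt_fst.prodMk (((contDiffAt_norm ℝ h0).comp p contDiffAt_snd).prodMk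
    ((contDiffAt_complex_arg hp).comp p contDiffAt_snd))

/-- The chart `polarChart` rescaled by `ρ` and rotated by `ϑ`. -/
def scaledPolarChart (ρ ϑ : ℝ) (p : ℝ × ℂ) : ℝ × ℝ × ℝ :=
  (p.1, ρ * ‖p.2‖, ϑ + Complex.arg p.2)

/-- Multiplication of the middle coordinate by `ρ`. -/
def scaleMiddle (ρ : ℝ) : ℝ × ℝ × ℝ →L[ℝ] ℝ × ℝ × ℝ :=
  (ContinuousLinearMap.fst ℝ ℝ (ℝ × ℝ)).prod
    ((ρ • (ContinuousLinearMap.fst ℝ ℝ ℝ ∘L ContinuousLinearMap.snd ℝ ℝ (ℝ × ℝ))).prod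
      (ContinuousLinearMap.snd ℝ ℝ ℝ ∘L ContinuousLinearMap.snd ℝ ℝ (ℝ × ℝ)))

theorem norm_scaleMiddle_le {ρ : ℝ} (hρ : 0 ≤ ρ) : ‖scaleMiddle ρ‖ ≤ 1 + ρ := by
  refine ContinuousLinearMap.opNorm_le_bound _ (by linarith) ?_
  rintro ⟨a, b, c⟩
  have h1 : |a| ≤ max |a| (max |b| |c|) := le_max_left _ _
  have h2 : |b| ≤ max |a| (max |b| |c|) := (le_max_left _ _).trans (le_max_right _ _)
  have h3 : |c| ≤ max |a| (max |b| |c|) := (le_max_right _ _).trans (le_max_right _ _)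
  have h4 : 0 ≤ |b| := abs_nonneg b
  simp only [scaleMiddle, ContinuousLinearMap.prod_apply, Prod.norm_def, Real.norm_eq_abs,
    ContinuousLinearMap.coe_fst', smul_apply, ContinuousLinearMap.comp_apply,
    ContinuousLinearMap.coe_snd', smul_eq_mul, abs_mul, abs_of_nonneg hρ]
  refine max_le ?_ (max_le ?_ ?_) <;> nlinarith

theorem scaledPolarChart_eq (ρ ϑ : ℝ) :
    scaledPolarChart ρ ϑ = (scaleMiddle ρ ∘ polarChart) + fun _ => (0, 0, ϑ) := by
  funext p
  simp [scaledPolarChart, scaleMiddle, polarChart, add_comm]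

theorem contDiffAt_scaledPolarChart (ρ ϑ : ℝ) {p : ℝ × ℂ} (hp : p.2 ∈ Complex.slitPlane)
    {n : WithTop ℕ∞} : ContDiffAt ℝ n (scaledPolarChart ρ ϑ) p := by
  rw [scaledPolarChart_eq]
  exact (((scaleMiddle ρ).contDiff.contDiffAt).comp p (contDiffAt_polarChart hp)).add
    contDiffAt_const

/-- Up to a translation, `scaledPolarChart ρ ϑ` is the fixed chart `polarChart` followed by a linear
map of norm at most `1 + δ`, so its derivatives at `(b, 1)` are bounded uniformly in `ρ` and `ϑ`.
The form `K ^ i` is the one required by the estimate for derivatives of a composite. -/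
theorem exists_bound_iteratedFDeriv_scaledPolarChart (R δ : ℝ) (n : ℕ) :
    ∃ K : ℝ, 1 ≤ K ∧ ∀ b ∈ Icc (-R) R, ∀ ρ ∈ Ioo 0 δ, ∀ ϑ : ℝ, ∀ i : ℕ, 1 ≤ i → i ≤ n →
      ‖iteratedFDeriv ℝ i (scaledPolarChart ρ ϑ) (b, 1)‖ ≤ K ^ i := by
  have hopen : IsOpen ((univ : Set ℝ) ×ˢ Complex.slitPlane) :=
    isOpen_univ.prod Complex.isOpen_slitPlane
  have hsm : ContDiffOn ℝ ∞ polarChart (univ ×ˢ Complex.slitPlane) :=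
    fun p hp => (contDiffAt_polarChart hp.2).contDiffWithinAt
  have hb : ∀ i : ℕ, ∃ C, 0 ≤ C ∧ ∀ b ∈ Icc (-R) R,
      ‖iteratedFDeriv ℝ i polarChart (b, 1)‖ ≤ C := by
    intro i
    have hc : ContinuousOn (iteratedFDeriv ℝ i polarChart) (Icc (-R) R ×ˢ {(1 : ℂ)}) := by
      refine ((hsm.continuousOn_iteratedFDerivWithin (m := i) (by exact_mod_cast le_top)
        hopen.uniqueDiffOn).congr
        (fun x hx => (iteratedFDerivWithin_of_isOpen i hopen hx).symm)).mono ?_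
      rintro ⟨b, w⟩ ⟨-, hw⟩
      simp only [mem_singleton_iff] at hw
      subst hw
      exact ⟨mem_univ _, Complex.one_mem_slitPlane⟩
    obtain ⟨C, hC⟩ := (isCompact_Icc.prod isCompact_singleton).exists_bound_of_continuousOn hc
    exact ⟨max C 0, le_max_right _ _, fun b hb => (hC (b, 1) ⟨hb, rfl⟩).trans (le_max_left _ _)⟩
  choose C hC0 hC using hb
  rcases le_or_gt δ 0 with hδ | hδ
  · exact ⟨1, le_rfl, fun b _ ρ hρ => absurd (hρ.1.trans hρ.2) (not_lt.2 hδ)⟩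
  -- The summand `1` makes the constant at least `1`, hence bounded by its `i`-th power for `i ≥ 1`.
  refine ⟨1 + (1 + δ) * ∑ i ∈ Finset.range (n + 1), C i, ?_, fun b hb ρ hρ ϑ i hi hin => ?_⟩
  · have : 0 ≤ ∑ i ∈ Finset.range (n + 1), C i := Finset.sum_nonneg fun i _ => hC0 i
    nlinarith [mul_nonneg (by linarith : (0 : ℝ) ≤ 1 + δ) this]
  have hsum : C i ≤ ∑ i ∈ Finset.range (n + 1), C i :=
    Finset.single_le_sum (f := C) (fun i _ => hC0 i) (Finset.mem_range.2 (by omega))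
  have hsum0 : 0 ≤ ∑ i ∈ Finset.range (n + 1), C i := (hC0 i).trans hsum
  have h1 : ContDiffAt ℝ i polarChart (b, 1) := contDiffAt_polarChart Complex.one_mem_slitPlane
  have h2 : ContDiffAt ℝ i (scaleMiddle ρ ∘ polarChart) (b, 1) :=
    ((scaleMiddle ρ).contDiff.contDiffAt).comp _ h1
  rw [scaledPolarChart_eq, iteratedFDeriv_add_apply h2 contDiffAt_const,
    iteratedFDeriv_const_of_ne (by omega), Pi.zero_apply, add_zero]
  have h3 := (scaleMiddle ρ).norm_iteratedFDeriv_comp_left h1 (n := i) le_rfl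
  have h4 : 0 ≤ (1 + δ) * ∑ i ∈ Finset.range (n + 1), C i := by positivity
  calc _ ≤ _ := h3
    _ ≤ (1 + δ) * C i := by
        gcongr
        · exact (norm_scaleMiddle_le hρ.1.le).trans (by linarith [hρ.2])
        · exact hC i b hb
    _ ≤ 1 + (1 + δ) * ∑ i ∈ Finset.range (n + 1), C i := by nlinarith
    _ ≤ _ := le_self_pow₀ (by linarith) (by omega)

/-- Multiplication of the second factor by a complex number. -/
def mulSnd (c : ℂ) : ℝ × ℂ →L[ℝ] ℝ × ℂ :=
  (ContinuousLinearMap.fst ℝ ℝ ℂ).prod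
    ((ContinuousLinearMap.mul ℝ ℂ c) ∘L ContinuousLinearMap.snd ℝ ℝ ℂ)

theorem mulSnd_apply (c : ℂ) (p : ℝ × ℂ) : mulSnd c p = (p.1, c * p.2) := rfl

theorem norm_mulSnd_le (c : ℂ) : ‖mulSnd c‖ ≤ 1 + ‖c‖ := by
  refine ContinuousLinearMap.opNorm_le_bound _ (by positivity) ?_
  rintro ⟨a, w⟩
  have h1 : |a| ≤ max |a| ‖w‖ := le_max_left _ _
  have h2 : ‖w‖ ≤ max |a| ‖w‖ := le_max_right _ _
  have h3 : 0 ≤ |a| := abs_nonneg a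
  have h4 : 0 ≤ ‖c‖ := norm_nonneg c
  have h5 : 0 ≤ ‖w‖ := norm_nonneg w
  simp only [mulSnd_apply, Prod.norm_def, Real.norm_eq_abs, norm_mul]
  refine max_le ?_ ?_ <;> nlinarith

/-- Multiplication by `w₀⁻¹` moves the base point `w₀` to `1`, away from the cut of `arg`. The
singularity of polar coordinates at the origin is then carried entirely by this linear map, whose
norm is of order `1/|w₀|`. The identity is global because the lift does not see the choice of angle
modulo `2π`. -/
theorem uncurry_eq_polarLift_comp (u : ℝ → ℂ → ℝ) {w₀ : ℂ} (hw₀ : w₀ ≠ 0) :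
    uncurry u = (polarLift u ∘ scaledPolarChart ‖w₀‖ (Complex.arg w₀)) ∘ mulSnd w₀⁻¹ := by
  funext ⟨b, w⟩
  have h1 : ((‖w₀‖ * ‖w₀⁻¹ * w‖ : ℝ) : ℂ) *
      Complex.exp (((Complex.arg w₀ + Complex.arg (w₀⁻¹ * w) : ℝ) : ℂ) * Complex.I) = w := by
    have e1 := Complex.norm_mul_exp_arg_mul_I w₀
    have e2 := Complex.norm_mul_exp_arg_mul_I (w₀⁻¹ * w)
    calc _ = (‖w₀‖ * Complex.exp (Complex.arg w₀ * Complex.I)) *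
        (‖w₀⁻¹ * w‖ * Complex.exp (Complex.arg (w₀⁻¹ * w) * Complex.I)) := by
          push_cast [add_mul, Complex.exp_add]; ring
      _ = w := by rw [e1, e2, mul_inv_cancel_left₀ hw₀]
  simp only [uncurry, comp_apply, mulSnd_apply, scaledPolarChart, polarLift]
  rw [h1]

/-- The part of the chart domain that `scaledPolarChart ρ` maps into `polarDomain δ`. -/
def slitCylinder (r : ℝ) : Set (ℝ × ℂ) := univ ×ˢ (Complex.slitPlane ∩ ball 0 r)

theorem isOpen_slitCylinder (r : ℝ) : IsOpen (slitCylinder r) :=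
  isOpen_univ.prod (Complex.isOpen_slitPlane.inter isOpen_ball)

theorem mapsTo_scaledPolarChart {ρ δ : ℝ} (hρ : 0 < ρ) (ϑ : ℝ) :
    MapsTo (scaledPolarChart ρ ϑ) (slitCylinder (δ / ρ)) (polarDomain δ) := by
  rintro ⟨b, w⟩ ⟨-, -, hw⟩
  rw [mem_ball_zero_iff, lt_div_iff₀ hρ] at hw
  refine ⟨mem_univ _, ⟨mul_nonneg hρ.le (norm_nonneg w), ?_⟩, mem_univ _⟩
  simpa [scaledPolarChart, mul_comm] using hw

theorem one_mem_slitCylinder {r : ℝ} (hr : 1 < r) (b : ℝ) : (b, (1 : ℂ)) ∈ slitCylinder r :=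
  ⟨mem_univ _, Complex.one_mem_slitPlane, by simpa using hr⟩

theorem contDiffAt_uncurry_of_polarLift {δ : ℝ} {u : ℝ → ℂ → ℝ}
    (hu : ContDiffOn ℝ ∞ (polarLift u) (polarDomain δ)) (b : ℝ) {w : ℂ} (hw : w ≠ 0)
    (hwδ : ‖w‖ < δ) : ContDiffAt ℝ ∞ (uncurry u) (b, w) := by
  have hρ : 0 < ‖w‖ := norm_pos_iff.2 hw
  have h1 : ContDiffOn ℝ ∞ (polarLift u ∘ scaledPolarChart ‖w‖ (Complex.arg w))
      (slitCylinder (δ / ‖w‖)) :=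
    hu.comp (fun p hp => (contDiffAt_scaledPolarChart _ _ hp.2.1).contDiffWithinAt)
      (mapsTo_scaledPolarChart hρ _)
  have h2 := h1.contDiffAt ((isOpen_slitCylinder _).mem_nhds
    (one_mem_slitCylinder ((one_lt_div hρ).2 hwδ) b))
  rw [uncurry_eq_polarLift_comp u hw]
  refine ContDiffAt.comp _ ?_ (mulSnd w⁻¹).contDiff.contDiffAt
  rwa [mulSnd_apply, inv_mul_cancel₀ hw]

/-- By `uncurry_eq_polarLift_comp` an `n`-th Cartesian derivative is at most a constant times
`|w|^(-n)` times polar derivatives of order at most `n`. Decay of order `N + n` of the latter leaves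
`|w|^N`. -/
theorem norm_iteratedFDeriv_uncurry_le_pow {δ : ℝ} {u : ℝ → ℂ → ℝ}
    (hu : ContDiffOn ℝ ∞ (polarLift u) (polarDomain δ))
    (hflat : ∀ n b ϑ, iteratedFDerivWithin ℝ n (polarLift u) (polarDomain δ) (b, 0, ϑ) = 0)
    (R : ℝ) {r : ℝ} (hr : r < δ) (N n : ℕ) :
    ∃ C, 0 ≤ C ∧ ∀ b ∈ Icc (-R) R, ∀ w : ℂ, w ≠ 0 → ‖w‖ ≤ r →
      ‖iteratedFDeriv ℝ n (uncurry u) (b, w)‖ ≤ C * ‖w‖ ^ N := by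
  -- The box of half-width `max R π` contains both `b` and every value of `arg`.
  have hB := fun i => norm_iteratedFDerivWithin_le_pow_of_flat hu hflat (max R Real.pi) hr (N + n) i
  choose C hC0 hC using hB
  obtain ⟨K, hK1, hK⟩ := exists_bound_iteratedFDeriv_scaledPolarChart R δ n
  have hsum0 : 0 ≤ ∑ i ∈ Finset.range (n + 1), C i := Finset.sum_nonneg fun i _ => hC0 i
  refine ⟨n.factorial * (∑ i ∈ Finset.range (n + 1), C i) * K ^ n * (|δ| + 1) ^ n,
    by positivity, fun b hb w hw hwr => ?_⟩
  have hρ : 0 < ‖w‖ := norm_pos_iff.2 hw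
  have hwδ : ‖w‖ < δ := hwr.trans_lt hr
  have hS := isOpen_slitCylinder (δ / ‖w‖)
  have h1S : (b, (1 : ℂ)) ∈ slitCylinder (δ / ‖w‖) :=
    one_mem_slitCylinder ((one_lt_div hρ).2 hwδ) b
  have hQ : ContDiffOn ℝ ∞ (scaledPolarChart ‖w‖ (Complex.arg w)) (slitCylinder (δ / ‖w‖)) :=
    fun p hp => (contDiffAt_scaledPolarChart _ _ hp.2.1).contDiffWithinAt
  have hmaps := mapsTo_scaledPolarChart (δ := δ) hρ (Complex.arg w)
  have hVQ := hu.comp hQ hmaps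
  have hQ1 : scaledPolarChart ‖w‖ (Complex.arg w) (b, 1) = (b, ‖w‖, Complex.arg w) := by
    simp [scaledPolarChart]
  have harg : Complex.arg w ∈ Icc (-max R Real.pi) (max R Real.pi) :=
    ⟨(neg_le_neg (le_max_right _ _)).trans (Complex.neg_pi_lt_arg w).le,
      (Complex.arg_le_pi w).trans (le_max_right _ _)⟩
  have hb' : b ∈ Icc (-max R Real.pi) (max R Real.pi) :=
    ⟨(neg_le_neg (le_max_left _ _)).trans hb.1, hb.2.trans (le_max_left _ _)⟩
  have hmain := norm_iteratedFDerivWithin_comp_le (n := n) hu hQ (by exact_mod_cast le_top)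
    (uniqueDiffOn_polarDomain δ) hS.uniqueDiffOn hmaps h1S
    (C := (∑ i ∈ Finset.range (n + 1), C i) * ‖w‖ ^ (N + n)) (D := K)
    (fun i hi => by
      rw [hQ1]
      refine (hC i b hb' _ ⟨hρ.le, hwr⟩ _ harg).trans ?_
      gcongr
      exact Finset.single_le_sum (f := C) (fun i _ => hC0 i) (Finset.mem_range.2 (by omega)))
    (fun i hi hin => by
      rw [iteratedFDerivWithin_of_isOpen i hS h1S]
      exact hK b hb _ ⟨hρ, hwδ⟩ _ i hi hin)
  have hA : mulSnd w⁻¹ (b, w) = (b, 1) := by rw [mulSnd_apply, inv_mul_cancel₀ hw]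
  have hpre : IsOpen (mulSnd w⁻¹ ⁻¹' slitCylinder (δ / ‖w‖)) :=
    hS.preimage (mulSnd w⁻¹).continuous
  have hmem : (b, w) ∈ mulSnd w⁻¹ ⁻¹' slitCylinder (δ / ‖w‖) := by
    rw [mem_preimage, hA]; exact h1S
  have hcomp := (mulSnd w⁻¹).iteratedFDerivWithin_comp_right hVQ hS.uniqueDiffOn
    hpre.uniqueDiffOn (x := (b, w)) (by rw [hA]; exact h1S) (i := n) (by exact_mod_cast le_top)
  rw [← uncurry_eq_polarLift_comp u hw, iteratedFDerivWithin_of_isOpen n hpre hmem, hA] at hcomp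
  rw [hcomp]
  refine (ContinuousMultilinearMap.norm_compContinuousLinearMap_le _ _).trans ?_
  rw [Finset.prod_const, Finset.card_univ, Fintype.card_fin]
  have hnA : ‖mulSnd w⁻¹‖ ≤ (|δ| + 1) / ‖w‖ := by
    refine (norm_mulSnd_le _).trans ?_
    rw [norm_inv, le_div_iff₀ hρ, add_mul, inv_mul_cancel₀ hρ.ne', one_mul]
    linarith [le_abs_self δ]
  calc _ ≤ (n.factorial * ((∑ i ∈ Finset.range (n + 1), C i) * ‖w‖ ^ (N + n)) * K ^ n) *
        ((|δ| + 1) / ‖w‖) ^ n := by gcongr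
    _ = _ := by
      rw [div_pow, pow_add]
      field_simp

/-- A function on `ℝ × D²` whose lift to polar coordinates is smooth and vanishes to infinite
order along `ρ = 0` is smooth. -/
theorem contDiffOn_uncurry_of_polarLift_flat {δ : ℝ} (hδ : 0 < δ) {u : ℝ → ℂ → ℝ}
    (hu : ContDiffOn ℝ ∞ (polarLift u) (polarDomain δ))
    (hflat : ∀ n b ϑ, iteratedFDerivWithin ℝ n (polarLift u) (polarDomain δ) (b, 0, ϑ) = 0) :
    ContDiffOn ℝ ∞ (uncurry u) (univ ×ˢ ball 0 δ) := by
  have hS : IsOpen ((univ : Set ℝ) ×ˢ ball (0 : ℂ) δ) := isOpen_univ.prod isOpen_ball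
  have hmem : ∀ b : ℝ, (b, (0 : ℂ)) ∈ (univ : Set ℝ) ×ˢ ball (0 : ℂ) δ :=
    fun b => ⟨mem_univ _, mem_ball_self hδ⟩
  set S := (univ : Set ℝ) ×ˢ ball (0 : ℂ) δ with hSdef
  -- If the `n`-th derivative vanishes along the axis, quadratic decay nearby makes it
  -- differentiable there with derivative zero.
  have zero_step : ∀ n : ℕ, (∀ b : ℝ, iteratedFDerivWithin ℝ n (uncurry u) S (b, 0) = 0) →
      ∀ b : ℝ, HasFDerivAt (iteratedFDerivWithin ℝ n (uncurry u) S)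
        (0 : ℝ × ℂ →L[ℝ] ContinuousMultilinearMap ℝ (fun _ : Fin n => ℝ × ℂ) ℝ) (b, 0) := by
    intro n hn b
    obtain ⟨C, hC0, hC⟩ := norm_iteratedFDeriv_uncurry_le_pow hu hflat (|b| + 1)
      (half_lt_self hδ) 2 n
    refine .of_isLittleO ?_
    rw [hn b]
    have hO : (fun p : ℝ × ℂ => iteratedFDerivWithin ℝ n (uncurry u) S p)
        =O[nhds (b, 0)] fun p => ‖p - (b, 0)‖ ^ 2 := by
      refine Asymptotics.IsBigO.of_bound C ?_
      have hnear : Ioo (b - 1) (b + 1) ×ˢ ball (0 : ℂ) (δ / 2) ∈ nhds (b, (0 : ℂ)) :=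
        prod_mem_nhds (Ioo_mem_nhds (by linarith) (by linarith)) (ball_mem_nhds _ (by positivity))
      filter_upwards [hnear] with p hp
      obtain ⟨b', w⟩ := p
      obtain ⟨hb', hw⟩ := hp
      rcases eq_or_ne w 0 with rfl | hw0
      · rw [hn b', norm_zero]; positivity
      rw [mem_ball_zero_iff] at hw
      rw [iteratedFDerivWithin_of_isOpen n hS ⟨mem_univ _, by
        rw [mem_ball_zero_iff]; dsimp only; linarith⟩]
      have hb'' : b' ∈ Icc (-(|b| + 1)) (|b| + 1) := by
        dsimp only at hb'
        constructor <;> linarith [hb'.1, hb'.2, le_abs_self b, neg_abs_le b]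
      refine (hC b' hb'' w hw0 hw.le).trans ?_
      have : ‖w‖ ≤ ‖(b', w) - (b, 0)‖ := by
        simp
      rw [norm_pow, norm_norm]
      gcongr
    have := hO.trans_isLittleO (Asymptotics.isLittleO_norm_pow_norm_pow one_lt_two (E' := ℝ × ℂ)
      |>.comp_tendsto (k := fun p : ℝ × ℂ => p - (b, 0)) (l' := nhds (b, 0))
        (by
          have : Filter.Tendsto (fun p : ℝ × ℂ => p - (b, 0)) (nhds (b, 0))
              (nhds ((b, 0) - (b, 0))) := (continuous_id.sub continuous_const).tendsto _
          rwa [sub_self] at this))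
    simpa [Function.comp_def] using this.norm_right
  have zero : ∀ n : ℕ, ∀ b : ℝ, iteratedFDerivWithin ℝ n (uncurry u) S (b, 0) = 0 := by
    intro n
    induction n with
    | zero =>
      intro b
      have := congrArg (fun m => m 0) (hflat 0 b 0)
      ext m
      simpa [polarLift] using this
    | succ n ih =>
      intro b
      have h1 : fderivWithin ℝ (iteratedFDerivWithin ℝ n (uncurry u) S) S (b, 0) = 0 := by
        rw [fderivWithin_of_isOpen hS (hmem b), (zero_step n ih b).fderiv]
      ext m
      rw [iteratedFDerivWithin_succ_apply_left, h1]
      rfl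
  -- It suffices that every iterated derivative is differentiable: on the axis by `zero_step`,
  -- elsewhere because polar coordinates are a local diffeomorphism.
  refine contDiffOn_of_differentiableOn (n := ⊤) fun m _ => ?_
  rintro ⟨b, w⟩ hp
  rcases eq_or_ne w 0 with rfl | hw
  · exact (zero_step m (zero m) b).differentiableAt.differentiableWithinAt
  have hw' : ‖w‖ < δ := by simpa using hp.2
  have h1 := contDiffAt_uncurry_of_polarLift hu b hw hw'
  have h2 : DifferentiableAt ℝ (iteratedFDeriv ℝ m (uncurry u)) (b, w) :=
    h1.differentiableAt_iteratedFDeriv (by exact_mod_cast ENat.natCast_lt_top m)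
  refine (h2.congr_of_eventuallyEq ?_).differentiableWithinAt
  filter_upwards [hS.mem_nhds hp] with x hx using iteratedFDerivWithin_of_isOpen m hS hx

/-! ### The Hamiltonian near the boundary of the disc -/

/-- The primitive is half the contraction of `ω` with the radial field, so `λ(X) = ω(z, X)/2 = -ω(X,
z)/2 = -dH(z)/2`. This turns the contact condition at the boundary into a statement about a radial
derivative. -/
theorem liouvilleForm_hamiltonianField (H : ℝ → ℂ → ℝ) (s : ℝ) (z : ℂ) :
    liouvilleForm z (hamiltonianField H s z) = -(spatialDeriv H s z z) / 2 := by
  have hz : spatialDeriv H s z z =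
      z.re * spatialDeriv H s z 1 + z.im * spatialDeriv H s z Complex.I := by
    conv_lhs => rw [show z = z.re • (1 : ℂ) + z.im • Complex.I by apply Complex.ext <;> simp]
    rw [map_add, map_smul, map_smul, smul_eq_mul, smul_eq_mul]
    congr 3 <;> (congr 1; apply Complex.ext <;> simp)
  rw [hz]
  simp only [liouvilleForm, hamiltonianField]
  ring

theorem uniqueDiffOn_disc : UniqueDiffOn ℝ disc :=
  uniqueDiffOn_convex (convex_closedBall 0 1) (by
    rw [disc, interior_closedBall _ one_ne_zero]; exact ⟨0, mem_ball_self one_pos⟩)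

namespace IsPeriodicHamiltonian

variable {H : ℝ → ℂ → ℝ}

theorem periodic_int (hH : IsPeriodicHamiltonian H) (k : ℤ) (s : ℝ) {z : ℂ} (hz : z ∈ disc) :
    H (s + k * (2 * Real.pi)) z = H s z := by
  have hp : Function.Periodic (fun s => H s z) (2 * Real.pi) := fun s => hH.periodic s z hz
  exact hp.int_mul k s

theorem contDiffAt (hH : IsPeriodicHamiltonian H) (s : ℝ) {z : ℂ} (hz : ‖z‖ < 1) :
    ContDiffAt ℝ ∞ (uncurry H) (s, z) :=
  hH.smooth.contDiffAt (prod_mem_nhds Filter.univ_mem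
    (closedBall_mem_nhds_of_mem (by simpa using hz)))

theorem contDiffOn_slice (hH : IsPeriodicHamiltonian H) (s : ℝ) : ContDiffOn ℝ ∞ (H s) disc :=
  hH.smooth.comp (f := fun z => (s, z)) (contDiff_prodMk_right s).contDiffOn
    (fun _ hz => ⟨mem_univ _, hz⟩)

theorem hasFDerivWithinAt_slice (hH : IsPeriodicHamiltonian H) (s : ℝ) {z : ℂ} (hz : z ∈ disc) :
    HasFDerivWithinAt (H s) (spatialDeriv H s z) disc z :=
  (((hH.contDiffOn_slice s).differentiableOn (by simp)) z hz).hasFDerivWithinAt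

end IsPeriodicHamiltonian

/-- Along the binding the continuous extension `f` is twice the value of `H_s ds + λ` on
`∂_s + X_s`. -/
theorem extension_apply_zero {H : ℝ → ℂ → ℝ} {h : ℕ} {δ : ℝ} (hδ : 0 < δ) (hδ1 : δ ≤ 1)
    (hH : IsPeriodicHamiltonian H)
    (hbdry : ∀ s : ℝ, ∀ z ∈ sphere (0 : ℂ) 1, H s z = h)
    {f : ℝ → ℂ → ℝ}
    (hf : ∀ b ϑ : ℝ, ∀ ρ ∈ Ioo 0 δ,
      f b ((ρ : ℂ) * Complex.exp ((ϑ : ℂ) * Complex.I)) =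
        (uncurry H (bindingMap h b ρ ϑ) - h * (1 - ρ ^ 2) ^ 2) / ρ ^ 2)
    (hfcont : ContinuousOn (uncurry f) (univ ×ˢ ball 0 δ)) (b : ℝ) :
    f b 0 = 2 * (H 0 (Complex.exp (b * Complex.I)) +
      liouvilleForm (Complex.exp (b * Complex.I))
        (hamiltonianField H 0 (Complex.exp (b * Complex.I)))) := by
  set e := Complex.exp (b * Complex.I) with he
  have hen : ‖e‖ = 1 := Complex.norm_exp_ofReal_mul_I b
  have hed : e ∈ disc := by simp [disc, hen]
  have hHe : H 0 e = h := hbdry 0 e (by simp [hen])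
  rw [liouvilleForm_hamiltonianField, hHe]
  -- The parameter is `τ = ρ²`, the distance to the boundary circle. The derivative is one-sided
  -- because `H` is only controlled on the closed disc.
  have hline : HasDerivWithinAt (fun τ : ℝ => H 0 (((1 - τ : ℝ) : ℂ) * e))
      (spatialDeriv H 0 e (-e)) (Icc 0 1) 0 := by
    have h1 : HasDerivWithinAt (fun τ : ℝ => ((1 - τ : ℝ) : ℂ) * e) (-e) (Icc 0 1) 0 := by
      have : HasDerivAt (fun τ : ℝ => ((1 - τ : ℝ) : ℂ) * e) (((-1 : ℝ) : ℂ) * e) 0 :=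
        ((HasDerivAt.const_sub (1 : ℝ) (hasDerivAt_id (0 : ℝ))).ofReal_comp).mul_const e
      simpa using this.hasDerivWithinAt
    have h2 := hH.hasFDerivWithinAt_slice 0 (z := ((1 - (0 : ℝ) : ℝ) : ℂ) * e) (by simpa using hed)
    have := h2.comp_hasDerivWithinAt (0 : ℝ) h1 (fun τ hτ => by
      have : |1 - τ| ≤ 1 := by rw [abs_le]; constructor <;> linarith [hτ.1, hτ.2]
      simpa [disc, hen, ← Complex.ofReal_one, ← Complex.ofReal_sub] using this)
    simpa [Function.comp_def] using this
  have hslope := (hasDerivWithinAt_iff_tendsto_slope' (by simp)).1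
    (hline.mono (Ioo_subset_Icc_self (a := (0 : ℝ)) (b := 1)))
  have hsq : Filter.Tendsto (fun ρ : ℝ => ρ ^ 2) (nhdsWithin 0 (Ioo 0 δ))
      (nhdsWithin 0 (Ioo 0 1)) := by
    refine tendsto_nhdsWithin_iff.2 ⟨?_, ?_⟩
    · have : Filter.Tendsto (fun ρ : ℝ => ρ ^ 2) (nhds 0) (nhds (0 ^ 2)) :=
        (continuous_pow 2).tendsto 0
      rw [zero_pow two_ne_zero] at this
      exact this.mono_left nhdsWithin_le_nhds
    · filter_upwards [self_mem_nhdsWithin] with ρ hρ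
      exact ⟨pow_pos hρ.1 2, by nlinarith [hρ.1, hρ.2]⟩
  have hlim1 := (hslope.comp hsq).add (((hsq.mono_right nhdsWithin_le_nhds).const_sub 2).const_mul
    (h : ℝ))
  have hlim2 : Filter.Tendsto (fun ρ : ℝ => f b ρ) (nhdsWithin 0 (Ioo 0 δ)) (nhds (f b 0)) := by
    have hc : ContinuousAt (uncurry f) (b, 0) := hfcont.continuousAt
      ((isOpen_univ.prod isOpen_ball).mem_nhds ⟨mem_univ _, mem_ball_self hδ⟩)
    have h2 : Filter.Tendsto (fun ρ : ℝ => (b, (ρ : ℂ))) (nhds 0) (nhds (b, ((0 : ℝ) : ℂ))) :=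
      (continuous_const.prodMk Complex.continuous_ofReal).tendsto 0
    rw [Complex.ofReal_zero] at h2
    exact (hc.tendsto.comp h2).mono_left nhdsWithin_le_nhds
  -- Since `(1 - (1-ρ²)²)/ρ² = 2 - ρ²`, the quotient splits into a difference quotient of `H` at the
  -- boundary, where `H = h`, and a term tending to `2h`. The limit is `2h - dH(e)`.
  have heq : ∀ ρ ∈ Ioo 0 δ, slope (fun τ : ℝ => H 0 (((1 - τ : ℝ) : ℂ) * e)) 0 (ρ ^ 2) +
      h * (2 - ρ ^ 2) = f b ρ := by
    intro ρ hρ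
    have h1 := hf b 0 ρ hρ
    simp only [Complex.ofReal_zero, zero_mul, Complex.exp_zero, mul_one] at h1
    rw [h1]
    have h2 : uncurry H (bindingMap h b ρ 0) = H 0 (((1 - ρ ^ 2 : ℝ) : ℂ) * e) := by
      simp [bindingMap, uncurry, he]
    rw [h2, slope_def_field]
    have h0 : H 0 (((1 - (0 : ℝ) : ℝ) : ℂ) * e) = h := by simpa using hHe
    rw [h0]
    have := hρ.1.ne'
    field_simp
    ring
  have hlim3 := hlim1.congr' (by
    filter_upwards [self_mem_nhdsWithin] with ρ hρ using heq ρ hρ)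
  have : (nhdsWithin (0 : ℝ) (Ioo 0 δ)).NeBot := by
    rw [← mem_closure_iff_nhdsWithin_neBot, closure_Ioo hδ.ne]; exact ⟨le_rfl, hδ.le⟩
  rw [tendsto_nhds_unique hlim2 hlim3, map_neg]
  ring

/-! ### The open book coordinates and the coefficient of the contact form -/

/-- The identification of `S¹ × Int D²` with the complement of the binding in `S³`. -/
def openBookMap (h : ℕ) (s : ℝ) (z : ℂ) : ℂ × ℂ :=
  (z * Complex.exp ((h * s : ℝ) * Complex.I), √(1 - ‖z‖ ^ 2) * Complex.exp (s * Complex.I))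

theorem norm_exp_mul_I (s : ℝ) : ‖Complex.exp (s * Complex.I)‖ = 1 :=
  Complex.norm_exp_ofReal_mul_I s

theorem one_sub_sq_nonneg_of_mem_disc {z : ℂ} (hz : z ∈ disc) : 0 ≤ 1 - ‖z‖ ^ 2 := by
  have : ‖z‖ ≤ 1 := by simpa [disc] using hz
  nlinarith [norm_nonneg z]

theorem openBookMap_mem (h : ℕ) (s : ℝ) {z : ℂ} (hz : z ∈ disc) :
    openBookMap h s z ∈ sphereThree := by
  have := one_sub_sq_nonneg_of_mem_disc hz
  simp only [sphereThree, mem_ofPred_eq, openBookMap, norm_mul, norm_exp_mul_I, mul_one,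
    Complex.norm_real, Real.norm_eq_abs, sq_abs, Real.sq_sqrt this]
  ring

/-- Radial projection to the unit sphere. -/
def radialProj (x : ℂ × ℂ) : ℂ × ℂ := (√(‖x.1‖ ^ 2 + ‖x.2‖ ^ 2))⁻¹ • x

theorem normSq_pos {x : ℂ × ℂ} (hx : x ≠ 0) : 0 < ‖x.1‖ ^ 2 + ‖x.2‖ ^ 2 := by
  rcases eq_or_ne x.1 0 with h1 | h1
  · have h2 : x.2 ≠ 0 := fun h2 => hx (Prod.ext h1 h2)
    have := norm_pos_iff.2 h2
    positivity
  · have := norm_pos_iff.2 h1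
    positivity

theorem radialProj_mem {x : ℂ × ℂ} (hx : x ≠ 0) : radialProj x ∈ sphereThree := by
  have h := normSq_pos hx
  simp only [sphereThree, mem_ofPred_eq, radialProj, Prod.smul_fst, Prod.smul_snd, norm_smul,
    norm_inv, Real.norm_eq_abs, mul_pow, inv_pow, sq_abs, Real.sq_sqrt h.le]
  field_simp

theorem radialProj_eq_self {x : ℂ × ℂ} (hx : x ∈ sphereThree) : radialProj x = x := by
  have : ‖x.1‖ ^ 2 + ‖x.2‖ ^ 2 = 1 := hx
  simp [radialProj, this]

theorem contDiff_normSq {n : WithTop ℕ∞} :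
    ContDiff ℝ n fun x : ℂ × ℂ => ‖x.1‖ ^ 2 + ‖x.2‖ ^ 2 :=
  (contDiff_fst.norm_sq ℝ).add (contDiff_snd.norm_sq ℝ)

theorem contDiffAt_radialProj {x : ℂ × ℂ} (hx : x ≠ 0) {n : WithTop ℕ∞} :
    ContDiffAt ℝ n radialProj x := by
  have h := normSq_pos hx
  exact ((contDiff_normSq.contDiffAt.sqrt h.ne').inv (Real.sqrt_ne_zero'.2 h)).smul contDiffAt_id

theorem ne_zero_of_mem_sphereThree {x : ℂ × ℂ} (hx : x ∈ sphereThree) : x ≠ 0 := by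
  rintro rfl
  simp [sphereThree] at hx

/-- The coefficient `F` of the contact form `r₁² dθ₁ + F r₂² dθ₂`, on the sphere. -/
def sphereCoeff (H f : ℝ → ℂ → ℝ) (h : ℕ) (x : ℂ × ℂ) : ℝ :=
  open Classical in
  if x.2 = 0 then f (Complex.arg x.1) 0 / 2
  else (H (Complex.arg x.2) (x.1 * Complex.exp (((-(h * Complex.arg x.2) : ℝ) : ℂ) * Complex.I)) -
    h * ‖x.1‖ ^ 2) / ‖x.2‖ ^ 2

theorem exists_int_eq_add_of_norm_mul_exp {w : ℂ} (hw : w ≠ 0) {s : ℝ}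
    (hs : w = ‖w‖ * Complex.exp (s * Complex.I)) :
    ∃ k : ℤ, s = Complex.arg w + k * (2 * Real.pi) := by
  have h1 := Complex.norm_mul_exp_arg_mul_I w
  have h2 : Complex.exp (s * Complex.I) = Complex.exp (Complex.arg w * Complex.I) :=
    mul_left_cancel₀ (Complex.ofReal_ne_zero.2 (norm_ne_zero_iff.2 hw)) (hs.symm.trans h1.symm)
  obtain ⟨k, hk⟩ := Complex.exp_eq_exp_iff_exists_int.1 h2
  refine ⟨k, ?_⟩
  have h3 : (s : ℂ) * Complex.I = ((Complex.arg w + k * (2 * Real.pi) : ℝ) : ℂ) * Complex.I := by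
    rw [hk]; push_cast; ring
  exact_mod_cast mul_right_cancel₀ Complex.I_ne_zero h3

theorem exp_neg_nat_mul_add_int (h : ℕ) (s : ℝ) (k : ℤ) :
    Complex.exp (((-(h * (s + k * (2 * Real.pi))) : ℝ) : ℂ) * Complex.I) =
      Complex.exp (((-(h * s) : ℝ) : ℂ) * Complex.I) := by
  rw [Complex.exp_eq_exp_iff_exists_int]
  exact ⟨-(h * k), by push_cast; ring⟩

section

variable {H f : ℝ → ℂ → ℝ} {h : ℕ}

/-- Any angle of `x₂` may replace the principal one: `H` is `2π`-periodic in `s`, and `e^{-ihs}` is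
too because `h` is an integer. -/
theorem sphereCoeff_eq_of_angle (hH : IsPeriodicHamiltonian H) {x : ℂ × ℂ} (hx1 : ‖x.1‖ ≤ 1)
    (hx2 : x.2 ≠ 0) {s : ℝ} (hs : x.2 = ‖x.2‖ * Complex.exp (s * Complex.I)) :
    sphereCoeff H f h x =
      (H s (x.1 * Complex.exp (((-(h * s) : ℝ) : ℂ) * Complex.I)) - h * ‖x.1‖ ^ 2) / ‖x.2‖ ^ 2 := by
  obtain ⟨k, rfl⟩ := exists_int_eq_add_of_norm_mul_exp hx2 hs
  rw [exp_neg_nat_mul_add_int, hH.periodic_int, sphereCoeff, if_neg hx2]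
  simpa [disc, -Complex.ofReal_neg, norm_exp_mul_I] using hx1

theorem sphereCoeff_openBookMap (hH : IsPeriodicHamiltonian H) (s : ℝ) {z : ℂ}
    (hz : z ∈ ball (0 : ℂ) 1) :
    sphereCoeff H f h (openBookMap h s z) = (H s z - h * ‖z‖ ^ 2) / (1 - ‖z‖ ^ 2) := by
  have hz1 : ‖z‖ < 1 := by simpa using hz
  have h0 : 0 < 1 - ‖z‖ ^ 2 := by nlinarith [norm_nonneg z]
  have hsq : 0 < √(1 - ‖z‖ ^ 2) := Real.sqrt_pos.2 h0
  have hn1 : ‖(openBookMap h s z).1‖ = ‖z‖ := by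
    simp only [openBookMap, norm_mul, norm_exp_mul_I, mul_one]
  have hn2 : ‖(openBookMap h s z).2‖ = √(1 - ‖z‖ ^ 2) := by
    simp only [openBookMap, norm_mul, norm_exp_mul_I, mul_one, Complex.norm_real,
      Real.norm_eq_abs, abs_of_pos hsq]
  have h2 : (openBookMap h s z).2 ≠ 0 := by rw [← norm_ne_zero_iff, hn2]; exact hsq.ne'
  rw [sphereCoeff_eq_of_angle hH (by rw [hn1]; exact hz1.le) h2 (s := s) (by rw [hn2]; rfl),
    hn1, hn2, Real.sq_sqrt h0.le]
  congr 3
  rw [openBookMap, mul_assoc, ← Complex.exp_add]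
  have : ((h * s : ℝ) : ℂ) * Complex.I + ((-(h * s) : ℝ) : ℂ) * Complex.I = 0 := by
    push_cast; ring
  rw [this, Complex.exp_zero, mul_one]

/-- On the sphere `|x₂|² = (1-|x₁|)(1+|x₁|)`, so `ρ = |x₂|/√(1+|x₁|)` satisfies `ρ² = 1 - |x₁|` and
is the radius appearing in `Φ`, while `b` is the angle of `x₁`. Dividing by `|x₂|²` instead of `ρ²`
accounts for the factor `1/(1+|x₁|)`, which equals `1/2` on the binding. Periodicity is needed only
at `x₂ = 0`, where the definition of the coefficient fixes the angle of `x₁` to be principal. -/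
theorem sphereCoeff_eq_near_binding {δ : ℝ}
    (hH : IsPeriodicHamiltonian H)
    (hf : ∀ b ϑ : ℝ, ∀ ρ ∈ Ioo 0 δ,
      f b ((ρ : ℂ) * Complex.exp ((ϑ : ℂ) * Complex.I)) =
        (uncurry H (bindingMap h b ρ ϑ) - h * (1 - ρ ^ 2) ^ 2) / ρ ^ 2)
    (hper : Function.Periodic (fun b => f b 0) (2 * Real.pi))
    {x : ℂ × ℂ} (hx : x ∈ sphereThree) (hx1 : x.1 ≠ 0) {b : ℝ}
    (hb : x.1 = ‖x.1‖ * Complex.exp (b * Complex.I))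
    (hδ : ‖x.2‖ / √(1 + ‖x.1‖) < δ) :
    sphereCoeff H f h x = f b ((√(1 + ‖x.1‖))⁻¹ • x.2) / (1 + ‖x.1‖) := by
  have hx' : ‖x.1‖ ^ 2 + ‖x.2‖ ^ 2 = 1 := hx
  have hn0 : 0 ≤ ‖x.1‖ := norm_nonneg _
  have h1n : 0 < 1 + ‖x.1‖ := by positivity
  have hsq : 0 < √(1 + ‖x.1‖) := Real.sqrt_pos.2 h1n
  rcases eq_or_ne x.2 0 with h2 | h2
  · obtain ⟨k, rfl⟩ := exists_int_eq_add_of_norm_mul_exp hx1 hb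
    have hn1 : ‖x.1‖ = 1 := by
      rw [h2, norm_zero] at hx'; nlinarith
    have := hper.int_mul k (Complex.arg x.1)
    rw [h2, smul_zero, this, sphereCoeff, if_pos h2, hn1]
    norm_num
  have hn2 : 0 < ‖x.2‖ := norm_pos_iff.2 h2
  set ρ := ‖x.2‖ / √(1 + ‖x.1‖) with hρ
  have hρ2 : ρ ^ 2 = 1 - ‖x.1‖ := by
    rw [hρ, div_pow, Real.sq_sqrt h1n.le, div_eq_iff h1n.ne']; linarith
  have hw : (√(1 + ‖x.1‖))⁻¹ • x.2 =
      (ρ : ℂ) * Complex.exp ((Complex.arg x.2 : ℂ) * Complex.I) := by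
    conv_lhs => rw [← Complex.norm_mul_exp_arg_mul_I x.2]
    rw [Complex.real_smul, hρ]
    push_cast
    ring
  rw [hw, hf b _ ρ ⟨by positivity, hδ⟩, sphereCoeff_eq_of_angle hH (s := Complex.arg x.2)
    (by nlinarith) h2 (Complex.norm_mul_exp_arg_mul_I x.2).symm, hρ2, div_div]
  have e1 : (1 - ‖x.1‖) * (1 + ‖x.1‖) = ‖x.2‖ ^ 2 := by linarith
  rw [e1]
  congr 1
  have e2 : bindingMap h b ρ (Complex.arg x.2) =
      (Complex.arg x.2, x.1 * Complex.exp (((-(h * Complex.arg x.2) : ℝ) : ℂ) * Complex.I)) := by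
    rw [bindingMap, hρ2]
    congr 1
    conv_rhs => rw [hb]
    rw [mul_assoc, ← Complex.exp_add, sub_sub_cancel]
    congr 2
    push_cast
    ring
  rw [e2, sub_sub_cancel]
  rfl

/-- A branch of the angle centred at `s₀`: rotating by `-s₀` before taking `arg` keeps the branch
smooth near any prescribed nonzero point of angle `s₀`, including those on the negative axis. -/
theorem exists_angle_eq (s₀ : ℝ) (w : ℂ) :
    w = ‖w‖ * Complex.exp (((s₀ + Complex.arg (w * Complex.exp ((-s₀ : ℝ) * Complex.I)) : ℝ) : ℂ) *
      Complex.I) := by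
  have h1 := Complex.norm_mul_exp_arg_mul_I (w * Complex.exp ((-s₀ : ℝ) * Complex.I))
  rw [norm_mul, norm_exp_mul_I, mul_one] at h1
  rw [Complex.ofReal_add, add_mul, Complex.exp_add, mul_left_comm, h1, mul_left_comm,
    ← Complex.exp_add]
  push_cast
  rw [neg_mul, add_neg_cancel, Complex.exp_zero, mul_one]

theorem contDiffAt_angle {w : ℂ} (hw : w ≠ 0) {s₀ : ℝ}
    (hs : w = ‖w‖ * Complex.exp (s₀ * Complex.I)) :
    ContDiffAt ℝ ∞ (fun w : ℂ =>
      s₀ + Complex.arg (w * Complex.exp ((-s₀ : ℝ) * Complex.I))) w := by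
  have h1 : w * Complex.exp ((-s₀ : ℝ) * Complex.I) = ‖w‖ := by
    conv_lhs => rw [hs]
    rw [mul_assoc, ← Complex.exp_add]
    push_cast
    rw [neg_mul, add_neg_cancel, Complex.exp_zero, mul_one]
  refine contDiffAt_const.add ?_
  refine ContDiffAt.comp w (g := Complex.arg) ?_ (contDiffAt_id.mul contDiffAt_const)
  rw [h1]
  exact contDiffAt_complex_arg (Complex.ofReal_mem_slitPlane.2 (norm_pos_iff.2 hw))

/-- The coefficient, extended from the sphere to be constant along rays, is smooth. -/
theorem contDiffAt_sphereCoeff_comp_radialProj {δ : ℝ} (hδ : 0 < δ)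
    (hH : IsPeriodicHamiltonian H)
    (hf : ∀ b ϑ : ℝ, ∀ ρ ∈ Ioo 0 δ,
      f b ((ρ : ℂ) * Complex.exp ((ϑ : ℂ) * Complex.I)) =
        (uncurry H (bindingMap h b ρ ϑ) - h * (1 - ρ ^ 2) ^ 2) / ρ ^ 2)
    (hper : Function.Periodic (fun b => f b 0) (2 * Real.pi))
    (hfs : ContDiffOn ℝ ∞ (uncurry f) (univ ×ˢ ball 0 δ))
    {x : ℂ × ℂ} (hx : x ∈ sphereThree) :
    ContDiffAt ℝ ∞ (sphereCoeff H f h ∘ radialProj) x := by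
  have hx0 := ne_zero_of_mem_sphereThree hx
  have hx' : ‖x.1‖ ^ 2 + ‖x.2‖ ^ 2 = 1 := hx
  have hN : ContDiffAt ℝ ∞ radialProj x := contDiffAt_radialProj hx0
  have hNx : radialProj x = x := radialProj_eq_self hx
  have hmem : ∀ᶠ y in nhds x, radialProj y ∈ sphereThree := by
    filter_upwards [isOpen_ne.mem_nhds hx0] with y hy using radialProj_mem hy
  -- On the binding, `F` is expressed through `f`, which is smooth across it. Off the binding it is
  -- expressed through `H` at an interior point of the disc. Both use angle branches centred at `x`.
  rcases eq_or_ne x.2 0 with h2 | h2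
  · have hn1 : ‖x.1‖ = 1 := by
      rw [h2, norm_zero] at hx'; nlinarith [norm_nonneg x.1]
    have h1 : x.1 ≠ 0 := by rw [← norm_ne_zero_iff, hn1]; exact one_ne_zero
    set β : ℂ → ℝ := fun w => Complex.arg x.1 +
      Complex.arg (w * Complex.exp ((-Complex.arg x.1 : ℝ) * Complex.I)) with hβ
    have hargx := (Complex.norm_mul_exp_arg_mul_I x.1).symm
    have hβs : ContDiffAt ℝ ∞ β x.1 := contDiffAt_angle h1 hargx
    set G : ℂ × ℂ → ℝ := fun y => f (β y.1) ((√(1 + ‖y.1‖))⁻¹ • y.2) / (1 + ‖y.1‖) with hG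
    have hnorm : ContDiffAt ℝ ∞ (fun y : ℂ × ℂ => 1 + ‖y.1‖) x :=
      contDiffAt_const.add (contDiffAt_fst.norm ℝ h1)
    have hpos : 1 + ‖x.1‖ ≠ 0 := by rw [hn1]; norm_num
    have hsm : ContDiffAt ℝ ∞ (fun y : ℂ × ℂ => (√(1 + ‖y.1‖))⁻¹ • y.2) x :=
      ((hnorm.sqrt hpos).inv (by rw [hn1]; exact Real.sqrt_ne_zero'.2 (by norm_num))).smul
        contDiffAt_snd
    have hGs : ContDiffAt ℝ ∞ G x := by
      refine ContDiffAt.div ?_ hnorm hpos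
      have hfx : ContDiffAt ℝ ∞ (uncurry f) (β x.1, (√(1 + ‖x.1‖))⁻¹ • x.2) :=
        hfs.contDiffAt ((isOpen_univ.prod isOpen_ball).mem_nhds ⟨mem_univ _, by
          rw [h2]; simpa using hδ⟩)
      exact ContDiffAt.comp x hfx ((hβs.comp x contDiffAt_fst).prodMk hsm)
    have hev : sphereCoeff H f h ∘ radialProj =ᶠ[nhds x] G ∘ radialProj := by
      have hc1 : ∀ᶠ y in nhds x, (radialProj y).1 ≠ 0 := by
        have : ContinuousAt (fun y => (radialProj y).1) x := hN.continuousAt.fst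
        exact this.eventually_ne (by rw [hNx]; exact h1)
      have hc2 : ∀ᶠ y in nhds x, ‖(radialProj y).2‖ / √(1 + ‖(radialProj y).1‖) < δ := by
        have : ContinuousAt (fun y => ‖(radialProj y).2‖ / √(1 + ‖(radialProj y).1‖)) x :=
          hN.continuousAt.snd.norm.div
            (continuousAt_const.add hN.continuousAt.fst.norm).sqrt
            (by rw [hNx, hn1]; exact Real.sqrt_ne_zero'.2 (by norm_num))
        exact this.eventually_lt continuousAt_const (by rw [hNx, h2]; simpa using hδ)
      filter_upwards [hmem, hc1, hc2] with y hy hy1 hy2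
      exact sphereCoeff_eq_near_binding hH hf hper hy hy1 (exists_angle_eq _ _) hy2
    refine ContDiffAt.congr_of_eventuallyEq ?_ hev
    refine ContDiffAt.comp x ?_ hN
    rwa [hNx]
  · have hargx := (Complex.norm_mul_exp_arg_mul_I x.2).symm
    set σ : ℂ → ℝ := fun w => Complex.arg x.2 +
      Complex.arg (w * Complex.exp ((-Complex.arg x.2 : ℝ) * Complex.I)) with hσ
    have hσs : ContDiffAt ℝ ∞ σ x.2 := contDiffAt_angle h2 hargx
    have hσ2 : ContDiffAt ℝ ∞ (fun y : ℂ × ℂ => σ y.2) x := hσs.comp x contDiffAt_snd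
    have hn1 : ‖x.1‖ < 1 := by
      have := norm_pos_iff.2 h2
      nlinarith [norm_nonneg x.1]
    set G : ℂ × ℂ → ℝ := fun y =>
      (H (σ y.2) (y.1 * Complex.exp (((-(h * σ y.2) : ℝ) : ℂ) * Complex.I)) - h * ‖y.1‖ ^ 2) /
        ‖y.2‖ ^ 2 with hG
    have hGs : ContDiffAt ℝ ∞ G x := by
      refine ContDiffAt.div (ContDiffAt.sub ?_ (contDiffAt_const.mul
        (contDiffAt_fst.norm_sq ℝ))) (contDiffAt_snd.norm_sq ℝ) (by
          have := norm_pos_iff.2 h2; positivity)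
      have hz : ContDiffAt ℝ ∞ (fun y : ℂ × ℂ =>
          y.1 * Complex.exp (((-(h * σ y.2) : ℝ) : ℂ) * Complex.I)) x := by
        refine contDiffAt_fst.mul (ContDiffAt.cexp ?_)
        exact (Complex.ofRealCLM.contDiff.contDiffAt.comp x
          (contDiffAt_const.mul hσ2).neg).mul contDiffAt_const
      exact ContDiffAt.comp x (g := uncurry H) (f := fun y : ℂ × ℂ => (σ y.2,
        y.1 * Complex.exp (((-(h * σ y.2) : ℝ) : ℂ) * Complex.I)))
        (hH.contDiffAt _ (by simpa [-Complex.ofReal_neg, norm_exp_mul_I] using hn1))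
        (hσ2.prodMk hz)
    have hev : sphereCoeff H f h ∘ radialProj =ᶠ[nhds x] G ∘ radialProj := by
      have hc1 : ∀ᶠ y in nhds x, (radialProj y).2 ≠ 0 := by
        have : ContinuousAt (fun y => (radialProj y).2) x := hN.continuousAt.snd
        exact this.eventually_ne (by rw [hNx]; exact h2)
      filter_upwards [hmem, hc1] with y hy hy1
      have hy' : ‖(radialProj y).1‖ ^ 2 + ‖(radialProj y).2‖ ^ 2 = 1 := hy
      have hle : ‖(radialProj y).1‖ ≤ 1 := by
        nlinarith [norm_nonneg (radialProj y).1, sq_nonneg ‖(radialProj y).2‖]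
      exact sphereCoeff_eq_of_angle hH hle hy1 (exists_angle_eq _ _)
    refine ContDiffAt.congr_of_eventuallyEq ?_ hev
    refine ContDiffAt.comp x ?_ hN
    rwa [hNx]

end

/-- What is needed of the coefficient `F` of the contact form `r₁² dθ₁ + F r₂² dθ₂` on `S³`:
smoothness, the relation with the Hamiltonian away from the binding, and positivity along the
binding. -/
structure IsContactCoeff (H : ℝ → ℂ → ℝ) (h : ℕ) (F : ℂ × ℂ → ℝ) : Prop where
  smooth : ∀ x ∈ sphereThree, ContDiffAt ℝ ∞ F x
  apply_openBookMap : ∀ s : ℝ, ∀ z ∈ ball (0 : ℂ) 1,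
    F (openBookMap h s z) = (H s z - h * ‖z‖ ^ 2) / (1 - ‖z‖ ^ 2)
  pos_on_binding : ∀ x ∈ sphereThree, x.2 = 0 → 0 < F x

/-- The hypotheses on `f` are used here and not later. Writing `f = (f - g) + g` with `f - g` flat
in polar coordinates makes `f` smooth across the binding. -/
theorem exists_isContactCoeff (H : ℝ → ℂ → ℝ) (h : ℕ) {δ : ℝ}
    (hH : IsPeriodicHamiltonian H)
    (hbdry : ∀ s : ℝ, ∀ z ∈ sphere (0 : ℂ) 1, H s z = h)
    (hcontact : ContactCondition H)
    (hδ : 0 < δ) (hδ1 : δ ≤ 1)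
    (f : ℝ → ℂ → ℝ)
    (hf : ∀ b ϑ : ℝ, ∀ ρ ∈ Ioo 0 δ,
      f b ((ρ : ℂ) * Complex.exp ((ϑ : ℂ) * Complex.I)) =
        (uncurry H (bindingMap h b ρ ϑ) - h * (1 - ρ ^ 2) ^ 2) / ρ ^ 2)
    (hfcont : ContinuousOn (uncurry f) (univ ×ˢ ball 0 δ))
    (hfsmooth : ContDiffOn ℝ ∞ (polarLift f) (polarDomain δ))
    (hfjet : ∃ g : ℝ → ℂ → ℝ,
      (∀ b : ℝ, ∀ w ∈ ball (0 : ℂ) δ, g (b + 2 * Real.pi) w = g b w) ∧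
      ContDiffOn ℝ ∞ (uncurry g) (univ ×ˢ ball 0 δ) ∧
      ∀ (n : ℕ) (b ϑ : ℝ),
        iteratedFDerivWithin ℝ n (polarLift f) (polarDomain δ) (b, 0, ϑ) =
          iteratedFDerivWithin ℝ n (polarLift g) (polarDomain δ) (b, 0, ϑ)) :
    ∃ F, IsContactCoeff H h F := by
  obtain ⟨g, hgper, hgs, hjet⟩ := hfjet
  have hfg : ∀ b, f b 0 = g b 0 := by
    intro b
    have := congrArg (fun m => m 0) (hjet 0 b 0)
    simpa [polarLift] using this
  -- Periodicity of `f` along the binding is inherited from `g` through the jet of order zero.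
  have hper : Function.Periodic (fun b => f b 0) (2 * Real.pi) := fun b => by
    simp only [hfg]; exact hgper b 0 (mem_ball_self hδ)
  have hgl : ContDiffOn ℝ ∞ (polarLift g) (polarDomain δ) := by
    have h1 : ContDiff ℝ ∞ fun p : ℝ × ℝ × ℝ =>
        (p.1, (p.2.1 : ℂ) * Complex.exp ((p.2.2 : ℂ) * Complex.I)) := by
      have ha : ContDiff ℝ ∞ fun p : ℝ × ℝ × ℝ => (p.2.1 : ℂ) :=
        Complex.ofRealCLM.contDiff.comp (contDiff_fst.comp contDiff_snd)
      have hb : ContDiff ℝ ∞ fun p : ℝ × ℝ × ℝ => (p.2.2 : ℂ) :=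
        Complex.ofRealCLM.contDiff.comp (contDiff_snd.comp contDiff_snd)
      exact contDiff_fst.prodMk (ha.mul (hb.mul contDiff_const).cexp)
    refine hgs.comp h1.contDiffOn ?_
    rintro ⟨b, ρ, ϑ⟩ ⟨-, hρ, -⟩
    refine ⟨mem_univ _, ?_⟩
    have h0 : |ρ| < δ := by rw [abs_of_nonneg hρ.1]; exact hρ.2
    simpa [norm_exp_mul_I] using h0
  have hfs : ContDiffOn ℝ ∞ (uncurry f) (univ ×ˢ ball 0 δ) := by
    have hlift : polarLift (fun b w => f b w - g b w) = polarLift f - polarLift g := rfl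
    have h1 := contDiffOn_uncurry_of_polarLift_flat hδ (u := fun b w => f b w - g b w)
      (by rw [hlift]; exact hfsmooth.sub hgl) (fun n b ϑ => by
        have hmem : ((b, 0, ϑ) : ℝ × ℝ × ℝ) ∈ polarDomain δ :=
          ⟨mem_univ _, ⟨le_rfl, hδ⟩, mem_univ _⟩
        rw [hlift, iteratedFDerivWithin_sub_apply
          ((hfsmooth _ hmem).of_le (by exact_mod_cast le_top))
          ((hgl _ hmem).of_le (by exact_mod_cast le_top)) (uniqueDiffOn_polarDomain δ) hmem,
          hjet, sub_self])
    refine (h1.add hgs).congr fun p _ => ?_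
    simp [uncurry]
  refine ⟨sphereCoeff H f h ∘ radialProj,
    fun x hx => contDiffAt_sphereCoeff_comp_radialProj hδ hH hf hper hfs hx, fun s z hz => ?_,
    fun x hx hx2 => ?_⟩
  · rw [comp_apply, radialProj_eq_self (openBookMap_mem h s (ball_subset_closedBall hz)),
      sphereCoeff_openBookMap hH s hz]
  -- Here `F = f/2 = H_0 + λ(X_0)` at the corresponding boundary point, so the contact condition at
  -- `s = 0` gives positivity.
  · rw [comp_apply, radialProj_eq_self hx, sphereCoeff, if_pos hx2,
      extension_apply_zero hδ hδ1 hH hbdry hf hfcont]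
    have := hcontact 0 (Complex.exp (Complex.arg x.1 * Complex.I)) (by
      simp [disc])
    linarith

/-! ### Rotation invariance of the standard forms on `ℂ` -/

theorem complex_inner_eq (z w : ℂ) : inner ℝ z w = z.re * w.re + z.im * w.im := by
  rw [Complex.inner]; simp; ring

theorem complex_norm_sq (z : ℂ) : ‖z‖ ^ 2 = z.re ^ 2 + z.im ^ 2 := by
  rw [← Complex.normSq_eq_norm_sq, Complex.normSq_apply]; ring

theorem liouvilleForm_mul {c : ℂ} (hc : ‖c‖ = 1) (z w : ℂ) :
    liouvilleForm (c * z) (c * w) = liouvilleForm z w := by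
  have : c.re ^ 2 + c.im ^ 2 = 1 := by rw [← complex_norm_sq, hc, one_pow]
  simp only [liouvilleForm, Complex.mul_re, Complex.mul_im]
  linear_combination (z.re * w.im - z.im * w.re) * this

theorem areaForm_mul {c : ℂ} (hc : ‖c‖ = 1) (z w : ℂ) :
    areaForm (c * z) (c * w) = areaForm z w := by
  have : c.re ^ 2 + c.im ^ 2 = 1 := by rw [← complex_norm_sq, hc, one_pow]
  simp only [areaForm, Complex.mul_re, Complex.mul_im]
  linear_combination 2 * (z.re * w.im - z.im * w.re) * this

theorem inner_mul_left_right {c : ℂ} (hc : ‖c‖ = 1) (z w : ℂ) :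
    inner ℝ (c * z) (c * w) = inner ℝ z w := by
  have : c.re ^ 2 + c.im ^ 2 = 1 := by rw [← complex_norm_sq, hc, one_pow]
  simp only [complex_inner_eq, Complex.mul_re, Complex.mul_im]
  linear_combination (z.re * w.re + z.im * w.im) * this

/-- Nondegeneracy of the area form. -/
theorem eq_of_forall_areaForm_eq {u v : ℂ} (h : ∀ w, areaForm u w = areaForm v w) : u = v := by
  have h1 := h 1
  have h2 := h Complex.I
  simp only [areaForm, Complex.one_re, Complex.one_im, Complex.I_re, Complex.I_im] at h1 h2
  apply Complex.ext <;> linarith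

/-! ### The contact form -/

/-- The form `liouvilleForm` as a continuous bilinear map. -/
def liouvilleCLM : ℂ →L[ℝ] ℂ →L[ℝ] ℝ :=
  Complex.reCLM.smulRight Complex.imCLM - Complex.imCLM.smulRight Complex.reCLM

theorem liouvilleCLM_apply (z w : ℂ) : liouvilleCLM z w = liouvilleForm z w := by
  simp [liouvilleCLM, liouvilleForm]

/-- The 1-form `r₁² dθ₁ + F r₂² dθ₂` on `ℂ²`. -/
def coeffForm (F : ℂ × ℂ → ℝ) (x : ℂ × ℂ) : (ℂ × ℂ) →L[ℝ] ℝ :=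
  liouvilleCLM x.1 ∘L ContinuousLinearMap.fst ℝ ℂ ℂ +
    F x • (liouvilleCLM x.2 ∘L ContinuousLinearMap.snd ℝ ℂ ℂ)

theorem coeffForm_apply (F : ℂ × ℂ → ℝ) (x v : ℂ × ℂ) :
    coeffForm F x v = liouvilleForm x.1 v.1 + F x * liouvilleForm x.2 v.2 := by
  simp [coeffForm, liouvilleCLM_apply]

theorem contDiffAt_coeffForm {F : ℂ × ℂ → ℝ} {x : ℂ × ℂ} {n : WithTop ℕ∞}
    (hF : ContDiffAt ℝ n F x) : ContDiffAt ℝ n (coeffForm F) x := by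
  have h1 : ContDiff ℝ n fun x : ℂ × ℂ => liouvilleCLM x.1 ∘L ContinuousLinearMap.fst ℝ ℂ ℂ :=
    (liouvilleCLM.contDiff.comp contDiff_fst).clm_comp contDiff_const
  have h2 : ContDiff ℝ n fun x : ℂ × ℂ => liouvilleCLM x.2 ∘L ContinuousLinearMap.snd ℝ ℂ ℂ :=
    (liouvilleCLM.contDiff.comp contDiff_snd).clm_comp contDiff_const
  exact h1.contDiffAt.add (hF.smul h2.contDiffAt)

theorem fderiv_coeffForm_apply {F : ℂ × ℂ → ℝ} {x : ℂ × ℂ} (hF : DifferentiableAt ℝ F x)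
    (v w : ℂ × ℂ) :
    fderiv ℝ (coeffForm F) x v w = liouvilleForm v.1 w.1 + F x * liouvilleForm v.2 w.2 +
      fderiv ℝ F x v * liouvilleForm x.2 w.2 := by
  have hα : DifferentiableAt ℝ (coeffForm F) x := by
    have h1 : Differentiable ℝ fun x : ℂ × ℂ =>
        liouvilleCLM x.1 ∘L ContinuousLinearMap.fst ℝ ℂ ℂ :=
      (liouvilleCLM.differentiable.comp differentiable_fst).clm_comp (differentiable_const _)
    have h2 : Differentiable ℝ fun x : ℂ × ℂ =>
        liouvilleCLM x.2 ∘L ContinuousLinearMap.snd ℝ ℂ ℂ :=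
      (liouvilleCLM.differentiable.comp differentiable_snd).clm_comp (differentiable_const _)
    exact (h1 x).add (hF.smul (h2 x))
  have h0 := hα.hasFDerivAt.clm_apply (hasFDerivAt_const w x)
  have h1 : HasFDerivAt (fun y : ℂ × ℂ => liouvilleCLM y.1 w.1 + F y * liouvilleCLM y.2 w.2)
      _ x := ((((liouvilleCLM.flip w.1).hasFDerivAt (x := x.1)).comp x hasFDerivAt_fst).add
        (hF.hasFDerivAt.mul (((liouvilleCLM.flip w.2).hasFDerivAt (x := x.2)).comp x
          hasFDerivAt_snd)))
  have h2 : (fun y => coeffForm F y w) =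
      fun y : ℂ × ℂ => liouvilleCLM y.1 w.1 + F y * liouvilleCLM y.2 w.2 := by
    funext y; simp [coeffForm]
  rw [h2] at h0
  have h3 := congrArg (fun L : (ℂ × ℂ) →L[ℝ] ℝ => L v) (h0.unique h1)
  simp only [add_apply, ContinuousLinearMap.comp_apply,
    ContinuousLinearMap.flip_apply, smul_apply, smul_eq_mul,
    ContinuousLinearMap.coe_fst', ContinuousLinearMap.coe_snd', liouvilleCLM_apply,
    zero_apply, map_zero, zero_add] at h3
  rw [h3]
  ring

theorem extD_coeffForm {F : ℂ × ℂ → ℝ} {x : ℂ × ℂ} (hF : DifferentiableAt ℝ F x)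
    (v w : ℂ × ℂ) :
    extD (coeffForm F) x v w = areaForm v.1 w.1 + F x * areaForm v.2 w.2 +
      fderiv ℝ F x v * liouvilleForm x.2 w.2 - fderiv ℝ F x w * liouvilleForm x.2 v.2 := by
  rw [extD, fderiv_coeffForm_apply hF, fderiv_coeffForm_apply hF]
  simp only [areaForm, liouvilleForm]
  ring

/-! ### Tangent vectors away from the binding -/

/-- The derivative of `openBookMap` at `(s, z)`, applied to `a = (σ, ζ)`. -/
def openBookTangent (h : ℕ) (s : ℝ) (z : ℂ) (a : ℝ × ℂ) : ℂ × ℂ :=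
  (Complex.exp ((h * s : ℝ) * Complex.I) * (a.2 + (h * a.1 : ℝ) * (Complex.I * z)),
    Complex.exp (s * Complex.I) *
      ⟨-inner ℝ z a.2 / √(1 - ‖z‖ ^ 2), a.1 * √(1 - ‖z‖ ^ 2)⟩)

theorem one_sub_sq_pos {z : ℂ} (hz : z ∈ ball (0 : ℂ) 1) : 0 < 1 - ‖z‖ ^ 2 := by
  have hz1 : ‖z‖ < 1 := by simpa using hz
  nlinarith [norm_nonneg z]

/-- Formulated along curves so that one computation serves the differential of the coordinates, the
lifts of Reeb orbits and the tangent vectors of the page. -/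
theorem hasDerivAt_openBookMap_comp (h : ℕ) {s : ℝ → ℝ} {z : ℝ → ℂ} {σ t : ℝ} {ζ : ℂ}
    (hs : HasDerivAt s σ t) (hz : HasDerivAt z ζ t) (hmem : z t ∈ ball (0 : ℂ) 1) :
    HasDerivAt (fun τ => openBookMap h (s τ) (z τ)) (openBookTangent h (s t) (z t) (σ, ζ)) t := by
  have h0 := one_sub_sq_pos hmem
  have h1 : HasDerivAt (fun τ => ((h * s τ : ℝ) : ℂ) * Complex.I) (((h * σ : ℝ) : ℂ) * Complex.I) t :=
    ((hs.const_mul (h : ℝ)).ofReal_comp).mul_const _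
  have h2 : HasDerivAt (fun τ => (s τ : ℂ) * Complex.I) ((σ : ℂ) * Complex.I) t :=
    hs.ofReal_comp.mul_const _
  have h3 : HasDerivAt (fun τ => √(1 - ‖z τ‖ ^ 2)) _ t :=
    ((hz.norm_sq).const_sub 1).sqrt h0.ne'
  have h4 := (hz.mul h1.cexp).prodMk (h3.ofReal_comp.mul h2.cexp)
  refine h4.congr_deriv (Prod.ext ?_ ?_)
  · simp only [openBookTangent]
    ring
  · simp only [openBookTangent]
    have e : ∀ a b : ℝ, (⟨a, b⟩ : ℂ) = a + b * Complex.I := fun a b => Complex.mk_eq_add_mul_I a b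
    rw [e]
    push_cast
    field_simp

theorem differentiableAt_openBookMap (h : ℕ) (s : ℝ) {z : ℂ} (hz : z ∈ ball (0 : ℂ) 1) :
    DifferentiableAt ℝ (uncurry (openBookMap h)) (s, z) := by
  have h0 := one_sub_sq_pos hz
  have h1 : DifferentiableAt ℝ (fun p : ℝ × ℂ => √(1 - ‖p.2‖ ^ 2)) (s, z) :=
    ((differentiableAt_snd.norm_sq ℝ).const_sub 1).sqrt h0.ne'
  have he : ∀ c : ℝ, DifferentiableAt ℝ
      (fun p : ℝ × ℂ => Complex.exp ((c * p.1 : ℝ) * Complex.I)) (s, z) := fun c =>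
    ((Complex.ofRealCLM.differentiableAt.comp (s, z)
      (differentiableAt_fst.const_mul c)).mul_const _).cexp
  have h2 := (differentiableAt_snd.mul (he h)).prodMk
    ((Complex.ofRealCLM.differentiableAt.comp (s, z) h1).mul (he 1))
  refine h2.congr_of_eventuallyEq (Filter.Eventually.of_forall fun p => ?_)
  simp [openBookMap, uncurry]

theorem fderiv_openBookMap (h : ℕ) (s : ℝ) {z : ℂ} (hz : z ∈ ball (0 : ℂ) 1) (a : ℝ × ℂ) :
    fderiv ℝ (uncurry (openBookMap h)) (s, z) a = openBookTangent h s z a := by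
  have hs : HasDerivAt (fun t : ℝ => s + t * a.1) a.1 0 := by
    simpa using ((hasDerivAt_id (0 : ℝ)).mul_const a.1).const_add s
  have hz' : HasDerivAt (fun t : ℝ => z + t * a.2) a.2 0 := by
    simpa using (((hasDerivAt_id (0 : ℝ)).ofReal_comp).mul_const a.2).const_add z
  have h1 := hasDerivAt_openBookMap_comp h hs hz' (by simpa using hz)
  have h2 : HasFDerivAt (uncurry (openBookMap h)) (fderiv ℝ (uncurry (openBookMap h)) (s, z))
      ((fun t : ℝ => (s + t * a.1, z + t * a.2)) 0) := by
    simpa using (differentiableAt_openBookMap h s hz).hasFDerivAt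
  have h3 := h2.comp_hasDerivAt (0 : ℝ) (hs.prodMk hz')
  have h4 := h3.unique h1
  simpa using h4

theorem isTangent_openBookTangent (h : ℕ) (s : ℝ) {z : ℂ} (hz : z ∈ ball (0 : ℂ) 1) (a : ℝ × ℂ) :
    IsTangent (openBookMap h s z) (openBookTangent h s z a) := by
  have hq := Real.sqrt_pos.2 (one_sub_sq_pos hz)
  rw [IsTangent, openBookMap, openBookTangent, mul_comm z, mul_comm ((√_ : ℝ) : ℂ),
    inner_mul_left_right (norm_exp_mul_I _), inner_mul_left_right (norm_exp_mul_I _)]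
  simp only [complex_inner_eq, Complex.add_re, Complex.add_im, Complex.re_ofReal_mul,
    Complex.im_ofReal_mul, Complex.I_mul_re, Complex.I_mul_im, Complex.ofReal_re,
    Complex.ofReal_im]
  field_simp
  ring

/-- After rotating both factors back, the imaginary part of the second component determines `σ` and
the first component then determines `ζ`. The remaining real part is forced by tangency to the
sphere. -/
theorem exists_eq_openBookTangent (h : ℕ) (s : ℝ) {z : ℂ} (hz : z ∈ ball (0 : ℂ) 1) {v : ℂ × ℂ}
    (hv : IsTangent (openBookMap h s z) v) : ∃ a, v = openBookTangent h s z a := by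
  have hq := Real.sqrt_pos.2 (one_sub_sq_pos hz)
  set q := √(1 - ‖z‖ ^ 2) with hqdef
  set E := Complex.exp (s * Complex.I) with hE
  set G := Complex.exp ((h * s : ℝ) * Complex.I) with hG
  have hE1 : ‖E‖ = 1 := norm_exp_mul_I s
  have hG1 : ‖G‖ = 1 := norm_exp_mul_I _
  obtain ⟨v1, hv1⟩ : ∃ w, v.1 = G * w :=
    ⟨G⁻¹ * v.1, by rw [mul_inv_cancel_left₀ (Complex.exp_ne_zero _)]⟩
  obtain ⟨v2, hv2⟩ : ∃ w, v.2 = E * w :=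
    ⟨E⁻¹ * v.2, by rw [mul_inv_cancel_left₀ (Complex.exp_ne_zero _)]⟩
  rw [IsTangent, openBookMap, ← hqdef, ← hE, ← hG, mul_comm z, mul_comm (q : ℂ), hv1, hv2,
    inner_mul_left_right hE1, inner_mul_left_right hG1] at hv
  simp only [complex_inner_eq, Complex.ofReal_re, Complex.ofReal_im] at hv
  refine ⟨(v2.im / q, v1 - (h * (v2.im / q) : ℝ) * (Complex.I * z)), Prod.ext ?_ ?_⟩
  · simp only [openBookTangent]
    rw [sub_add_cancel, hv1]
  · simp only [openBookTangent]
    rw [hv2, ← hqdef]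
    congr 1
    apply Complex.ext
    · simp only [complex_inner_eq, Complex.sub_re, Complex.sub_im, Complex.re_ofReal_mul,
        Complex.im_ofReal_mul, Complex.I_mul_re, Complex.I_mul_im]
      field_simp
      linear_combination q * hv
    · simp only
      field_simp

theorem exists_eq_openBookMap (h : ℕ) {x : ℂ × ℂ} (hx : x ∈ sphereThree) (hx2 : x.2 ≠ 0) :
    ∃ s : ℝ, ∃ z ∈ ball (0 : ℂ) 1, x = openBookMap h s z := by
  have hx' : ‖x.1‖ ^ 2 + ‖x.2‖ ^ 2 = 1 := hx
  set s := Complex.arg x.2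
  have hG : ‖(Complex.exp ((h * s : ℝ) * Complex.I))⁻¹‖ = 1 := by
    rw [norm_inv, norm_exp_mul_I, inv_one]
  have hn : ‖x.1 * (Complex.exp ((h * s : ℝ) * Complex.I))⁻¹‖ = ‖x.1‖ := by
    rw [norm_mul, hG, mul_one]
  refine ⟨s, x.1 * (Complex.exp ((h * s : ℝ) * Complex.I))⁻¹, ?_, Prod.ext ?_ ?_⟩
  · rw [mem_ball_zero_iff, hn]
    have := norm_pos_iff.2 hx2
    nlinarith [norm_nonneg x.1]
  · simp only [openBookMap]
    rw [inv_mul_cancel_right₀ (Complex.exp_ne_zero _)]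
  · simp only [openBookMap]
    rw [hn, ← hx', add_sub_cancel_left, Real.sqrt_sq (norm_nonneg _)]
    exact (Complex.norm_mul_exp_arg_mul_I x.2).symm

theorem openBookMap_snd_ne_zero (h : ℕ) (s : ℝ) {z : ℂ} (hz : z ∈ ball (0 : ℂ) 1) :
    (openBookMap h s z).2 ≠ 0 :=
  mul_ne_zero (Complex.ofReal_ne_zero.2 (Real.sqrt_pos.2 (one_sub_sq_pos hz)).ne')
    (Complex.exp_ne_zero _)

theorem spatialDeriv_eq_fderiv {H : ℝ → ℂ → ℝ} (hH : IsPeriodicHamiltonian H) (s : ℝ) {z : ℂ}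
    (hz : z ∈ ball (0 : ℂ) 1) (ζ : ℂ) :
    spatialDeriv H s z ζ = fderiv ℝ (uncurry H) (s, z) (0, ζ) := by
  have h1 : HasFDerivAt (uncurry H) (fderiv ℝ (uncurry H) (s, z)) (s, z) :=
    ((hH.contDiffAt s (by simpa using hz)).differentiableAt (by simp)).hasFDerivAt
  have h2 : HasFDerivAt (H s) _ z :=
    h1.comp z (f := fun w => (s, w)) ((hasFDerivAt_const s z).prodMk (hasFDerivAt_id z))
  have h3 : disc ∈ nhds z := closedBall_mem_nhds_of_mem hz
  rw [spatialDeriv, fderivWithin_of_mem_nhds h3, h2.fderiv]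
  simp

/-- The value `H_s + λ(X_s)` of the form `H_s ds + λ` on `∂_s + X_s`. -/
def reebDenominator (H : ℝ → ℂ → ℝ) (s : ℝ) (z : ℂ) : ℝ :=
  H s z + liouvilleForm z (hamiltonianField H s z)

/-- Splits `dH` as `∂_s H ds + ω(X_s, ·)`. The value of `∂_s H` is irrelevant below, since it enters
`dH ∧ ds` only through `ds ∧ ds = 0`. -/
theorem fderiv_uncurry_eq {H : ℝ → ℂ → ℝ} (hH : IsPeriodicHamiltonian H) (s : ℝ) {z : ℂ}
    (hz : z ∈ ball (0 : ℂ) 1) :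
    ∃ c : ℝ, ∀ a : ℝ × ℂ, fderiv ℝ (uncurry H) (s, z) a =
      c * a.1 + areaForm (hamiltonianField H s z) a.2 := by
  refine ⟨fderiv ℝ (uncurry H) (s, z) (1, 0), fun a => ?_⟩
  rw [areaForm_hamiltonianField, spatialDeriv_eq_fderiv hH s hz]
  conv_lhs => rw [show a = a.1 • ((1 : ℝ), (0 : ℂ)) + (0, a.2) by ext <;> simp]
  rw [map_add, map_smul, smul_eq_mul, mul_comm]

/-! ### The contact form in open book coordinates -/

namespace IsContactCoeff

variable {H : ℝ → ℂ → ℝ} {h : ℕ} {F : ℂ × ℂ → ℝ}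

theorem differentiableAt (hF : IsContactCoeff H h F) {x : ℂ × ℂ} (hx : x ∈ sphereThree) :
    DifferentiableAt ℝ F x :=
  (hF.smooth x hx).differentiableAt (by simp)

/-- The chain rule for the relation between `F` and `H`. -/
theorem fderiv_apply_openBookTangent (hF : IsContactCoeff H h F) (hH : IsPeriodicHamiltonian H)
    (s : ℝ) {z : ℂ} (hz : z ∈ ball (0 : ℂ) 1) (a : ℝ × ℂ) :
    fderiv ℝ F (openBookMap h s z) (openBookTangent h s z a) * (1 - ‖z‖ ^ 2) =
      fderiv ℝ (uncurry H) (s, z) a - 2 * h * inner ℝ z a.2 +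
        2 * F (openBookMap h s z) * inner ℝ z a.2 := by
  have hx := openBookMap_mem h s (ball_subset_closedBall hz)
  have h1 : HasFDerivAt (F ∘ uncurry (openBookMap h)) _ (s, z) :=
    HasFDerivAt.comp (s, z) (hF.differentiableAt hx).hasFDerivAt
      (differentiableAt_openBookMap h s hz).hasFDerivAt
  have hn : HasFDerivAt (fun p : ℝ × ℂ => ‖p.2‖ ^ 2) _ (s, z) :=
    (hasFDerivAt_snd (𝕜 := ℝ) (E := ℝ) (F := ℂ)).norm_sq
  have h2 := h1.mul (hn.const_sub 1)
  have hHd : HasFDerivAt (uncurry H) (fderiv ℝ (uncurry H) (s, z)) (s, z) :=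
    ((hH.contDiffAt s (by simpa using hz)).differentiableAt (by simp)).hasFDerivAt
  have h3 := hHd.sub (hn.const_mul (h : ℝ))
  have hev : (fun p : ℝ × ℂ => (F ∘ uncurry (openBookMap h)) p * (1 - ‖p.2‖ ^ 2)) =ᶠ[nhds (s, z)]
      fun p : ℝ × ℂ => uncurry H p - h * ‖p.2‖ ^ 2 := by
    filter_upwards [(isOpen_univ.prod isOpen_ball).mem_nhds
      (show (s, z) ∈ (univ : Set ℝ) ×ˢ ball (0 : ℂ) 1 from ⟨mem_univ _, hz⟩)] with p hp
    have := one_sub_sq_pos hp.2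
    simp only [comp_apply, uncurry, hF.apply_openBookMap p.1 p.2 hp.2]
    field_simp
  have h4 := congrArg (fun L : ℝ × ℂ →L[ℝ] ℝ => L a) ((h2.congr_of_eventuallyEq hev.symm).unique h3)
  simp only [add_apply, smul_apply, smul_eq_mul, comp_apply, ContinuousLinearMap.comp_apply,
    neg_apply, sub_apply, ContinuousLinearMap.coe_snd', innerSL_apply_apply,
    fderiv_openBookMap h s hz, nsmul_eq_mul, uncurry] at h4
  push_cast at h4
  linear_combination h4

/-- The pullback is `λ + (h|z|² + F(1-|z|²)) ds`, and the defining relation of `F` makes the bracket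
equal to `H`. -/
theorem coeffForm_openBookTangent (hF : IsContactCoeff H h F) (s : ℝ) {z : ℂ}
    (hz : z ∈ ball (0 : ℂ) 1) (a : ℝ × ℂ) :
    coeffForm F (openBookMap h s z) (openBookTangent h s z a) =
      H s z * a.1 + liouvilleForm z a.2 := by
  have h0 := one_sub_sq_pos hz
  have hsq := Real.sq_sqrt h0.le
  have hFx := hF.apply_openBookMap s z hz
  rw [eq_div_iff h0.ne'] at hFx
  rw [coeffForm_apply]
  set c := F (openBookMap h s z)
  set q := √(1 - ‖z‖ ^ 2)
  simp only [openBookMap, openBookTangent]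
  rw [mul_comm z, mul_comm (_ : ℂ) (Complex.exp (s * Complex.I)),
    liouvilleForm_mul (norm_exp_mul_I _), liouvilleForm_mul (norm_exp_mul_I _)]
  have hn := complex_norm_sq z
  simp only [liouvilleForm, Complex.add_re, Complex.add_im, Complex.re_ofReal_mul,
    Complex.im_ofReal_mul, Complex.I_mul_re, Complex.I_mul_im, Complex.ofReal_re,
    Complex.ofReal_im]
  linear_combination a.1 * hFx + c * a.1 * hsq - h * a.1 * hn

/-- The pullback of `dα` is `d(H ds + λ) = dH ∧ ds + ω`. It is verified pointwise: the derivatives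
of `F` in `extD_coeffForm` are eliminated with the chain rule `fderiv_apply_openBookTangent`. -/
theorem extD_openBookTangent (hF : IsContactCoeff H h F) (hH : IsPeriodicHamiltonian H) (s : ℝ)
    {z : ℂ} (hz : z ∈ ball (0 : ℂ) 1) (a b : ℝ × ℂ) :
    extD (coeffForm F) (openBookMap h s z) (openBookTangent h s z a) (openBookTangent h s z b) =
      fderiv ℝ (uncurry H) (s, z) a * b.1 - fderiv ℝ (uncurry H) (s, z) b * a.1 +
        areaForm a.2 b.2 := by
  have h0 := one_sub_sq_pos hz
  have hsq := Real.sq_sqrt h0.le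
  have hq := Real.sqrt_pos.2 h0
  rw [extD_coeffForm (hF.differentiableAt (openBookMap_mem h s (ball_subset_closedBall hz)))]
  have ha := hF.fderiv_apply_openBookTangent hH s hz a
  have hb := hF.fderiv_apply_openBookTangent hH s hz b
  set A := fderiv ℝ F (openBookMap h s z) (openBookTangent h s z a)
  set B := fderiv ℝ F (openBookMap h s z) (openBookTangent h s z b)
  set c := F (openBookMap h s z)
  set q := √(1 - ‖z‖ ^ 2)
  simp only [openBookMap, openBookTangent]
  rw [mul_comm (_ : ℂ) (Complex.exp (s * Complex.I)),
    liouvilleForm_mul (norm_exp_mul_I _), liouvilleForm_mul (norm_exp_mul_I _),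
    areaForm_mul (norm_exp_mul_I _), areaForm_mul (norm_exp_mul_I _)]
  simp only [complex_inner_eq] at ha hb ⊢
  rw [← hsq] at ha hb
  simp only [liouvilleForm, areaForm, Complex.add_re, Complex.add_im, Complex.re_ofReal_mul,
    Complex.im_ofReal_mul, Complex.I_mul_re, Complex.I_mul_im, Complex.ofReal_re,
    Complex.ofReal_im]
  field_simp
  linear_combination q * b.1 * ha - q * a.1 * hb

end IsContactCoeff

/-- The determinant of three vectors of `ℝ × ℂ`. -/
def tripleDet (a b c : ℝ × ℂ) : ℝ :=
  a.1 * (b.2.re * c.2.im - b.2.im * c.2.re) + b.1 * (c.2.re * a.2.im - c.2.im * a.2.re) +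
    c.1 * (a.2.re * b.2.im - a.2.im * b.2.re)

theorem tripleDet_ne_zero {a b c : ℝ × ℂ} (hl : LinearIndependent ℝ ![a, b, c]) :
    tripleDet a b c ≠ 0 := by
  let T : ℝ × ℂ →ₗ[ℝ] (Fin 3 → ℝ) := LinearMap.pi ![LinearMap.fst ℝ ℝ ℂ,
    Complex.reLm ∘ₗ LinearMap.snd ℝ ℝ ℂ, Complex.imLm ∘ₗ LinearMap.snd ℝ ℝ ℂ]
  have hT : ∀ p, T p = ![p.1, p.2.re, p.2.im] := by
    intro p; ext i; fin_cases i <;> simp [T]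
  have hker : LinearMap.ker T = ⊥ := by
    rw [LinearMap.ker_eq_bot']
    intro p hp
    rw [hT] at hp
    have h0 := congrFun hp 0
    have h1 := congrFun hp 1
    have h2 := congrFun hp 2
    simp at h0 h1 h2
    exact Prod.ext h0 (Complex.ext h1 h2)
  have h1 := hl.map' T hker
  let M : Matrix (Fin 3) (Fin 3) ℝ := Matrix.of (T ∘ ![a, b, c])
  have h2 : IsUnit M := Matrix.linearIndependent_rows_iff_isUnit.1 h1
  have h3 := (Matrix.isUnit_iff_isUnit_det M).1 h2 |>.ne_zero
  have h4 : M.det = tripleDet a b c := by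
    rw [Matrix.det_fin_three]
    simp [M, hT, tripleDet]
    ring
  rwa [h4] at h3

theorem linearIndependent_of_openBookTangent (h : ℕ) (s : ℝ) {z : ℂ} (hz : z ∈ ball (0 : ℂ) 1)
    {a b c : ℝ × ℂ} (hl : LinearIndependent ℝ ![openBookTangent h s z a, openBookTangent h s z b,
      openBookTangent h s z c]) : LinearIndependent ℝ ![a, b, c] := by
  refine LinearIndependent.of_comp
    (fderiv ℝ (uncurry (openBookMap h)) (s, z)).toLinearMap ?_
  have e : (fderiv ℝ (uncurry (openBookMap h)) (s, z)).toLinearMap ∘ ![a, b, c] =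
      ![openBookTangent h s z a, openBookTangent h s z b, openBookTangent h s z c] := by
    ext i : 1
    fin_cases i <;> simp [fderiv_openBookMap h s hz]
  rw [e]
  exact hl

/-! ### Tangent vectors along the binding -/

/-- The tangent vector of `S³` at the point `x` of the binding with coordinates `(σ, ζ)`. -/
def bindingTangent (x : ℂ × ℂ) (a : ℝ × ℂ) : ℂ × ℂ := (a.1 * (Complex.I * x.1), a.2)

theorem norm_fst_of_snd_eq_zero {x : ℂ × ℂ} (hx : x ∈ sphereThree) (hx2 : x.2 = 0) :
    x.1.re ^ 2 + x.1.im ^ 2 = 1 := by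
  have hx' : ‖x.1‖ ^ 2 + ‖x.2‖ ^ 2 = 1 := hx
  rw [hx2, norm_zero, complex_norm_sq] at hx'
  linarith

theorem exists_eq_bindingTangent {x v : ℂ × ℂ} (hx : x ∈ sphereThree) (hx2 : x.2 = 0)
    (hv : IsTangent x v) : ∃ a, v = bindingTangent x a := by
  have h1 := norm_fst_of_snd_eq_zero hx hx2
  rw [IsTangent, hx2, inner_zero_left, add_zero, complex_inner_eq] at hv
  refine ⟨(liouvilleForm x.1 v.1, v.2), Prod.ext (Complex.ext ?_ ?_) rfl⟩
  · simp only [bindingTangent, liouvilleForm, Complex.re_ofReal_mul, Complex.I_mul_re]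
    linear_combination -v.1.re * h1 + x.1.re * hv
  · simp only [bindingTangent, liouvilleForm, Complex.im_ofReal_mul, Complex.I_mul_im]
    linear_combination -v.1.im * h1 + x.1.im * hv

theorem linearIndependent_of_bindingTangent (x : ℂ × ℂ) {a b c : ℝ × ℂ}
    (hl : LinearIndependent ℝ ![bindingTangent x a, bindingTangent x b, bindingTangent x c]) :
    LinearIndependent ℝ ![a, b, c] := by
  let L : ℝ × ℂ →ₗ[ℝ] ℂ × ℂ :=
    ((LinearMap.fst ℝ ℝ ℂ).smulRight (Complex.I * x.1)).prod (LinearMap.snd ℝ ℝ ℂ)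
  have hL : ∀ a, L a = bindingTangent x a := fun a => by simp [L, bindingTangent]
  refine LinearIndependent.of_comp L ?_
  convert hl using 1
  ext i : 1
  fin_cases i <;> simp [hL]

/-! ### The contact condition and the direction of the Reeb field -/

namespace IsContactCoeff

variable {H : ℝ → ℂ → ℝ} {h : ℕ} {F : ℂ × ℂ → ℝ}

/-- At `x₂ = 0` the form `r₂² dθ₂` vanishes and with it the terms in `dF`; the components along `i
x₁` are parallel and span no area. Only `F ω` on the normal plane survives. -/
theorem extD_bindingTangent (hF : IsContactCoeff H h F) {x : ℂ × ℂ} (hx : x ∈ sphereThree)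
    (hx2 : x.2 = 0) (a b : ℝ × ℂ) :
    extD (coeffForm F) x (bindingTangent x a) (bindingTangent x b) = F x * areaForm a.2 b.2 := by
  rw [extD_coeffForm (hF.differentiableAt hx), hx2]
  simp only [bindingTangent, areaForm, liouvilleForm, Complex.re_ofReal_mul,
    Complex.im_ofReal_mul, Complex.zero_re, Complex.zero_im]
  ring

theorem coeffForm_bindingTangent {x : ℂ × ℂ} (hx : x ∈ sphereThree)
    (hx2 : x.2 = 0) (a : ℝ × ℂ) : coeffForm F x (bindingTangent x a) = a.1 := by
  have h1 := norm_fst_of_snd_eq_zero hx hx2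
  rw [coeffForm_apply, hx2]
  simp only [bindingTangent, liouvilleForm, Complex.re_ofReal_mul, Complex.im_ofReal_mul,
    Complex.zero_re, Complex.zero_im, Complex.I_mul_re, Complex.I_mul_im]
  linear_combination a.1 * h1

/-- In the respective coordinates `α ∧ dα` is `2F` times the determinant along the binding and
`2(H_s + λ(X_s))` times it elsewhere. Both factors are positive. -/
theorem isContactForm (hF : IsContactCoeff H h F) (hH : IsPeriodicHamiltonian H)
    (hcontact : ContactCondition H) : IsContactForm (coeffForm F) where
  smooth x hx := contDiffAt_coeffForm (hF.smooth x hx)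
  nondegenerate x hx u v w hu hv hw hl := by
    by_cases hx2 : x.2 = 0
    · obtain ⟨a, rfl⟩ := exists_eq_bindingTangent hx hx2 hu
      obtain ⟨b, rfl⟩ := exists_eq_bindingTangent hx hx2 hv
      obtain ⟨c, rfl⟩ := exists_eq_bindingTangent hx hx2 hw
      have hd := tripleDet_ne_zero (linearIndependent_of_bindingTangent x hl)
      simp only [hF.extD_bindingTangent hx hx2, coeffForm_bindingTangent hx hx2]
      have : a.1 * (F x * areaForm b.2 c.2) + b.1 * (F x * areaForm c.2 a.2) +
          c.1 * (F x * areaForm a.2 b.2) = 2 * F x * tripleDet a b c := by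
        simp only [areaForm, tripleDet]; ring
      rw [this]
      exact mul_ne_zero (mul_ne_zero two_ne_zero (hF.pos_on_binding x hx hx2).ne') hd
    · obtain ⟨s, z, hz, rfl⟩ := exists_eq_openBookMap h hx hx2
      obtain ⟨a, rfl⟩ := exists_eq_openBookTangent h s hz hu
      obtain ⟨b, rfl⟩ := exists_eq_openBookTangent h s hz hv
      obtain ⟨c, rfl⟩ := exists_eq_openBookTangent h s hz hw
      have hd := tripleDet_ne_zero (linearIndependent_of_openBookTangent h s hz hl)
      obtain ⟨k, hk⟩ := fderiv_uncurry_eq hH s hz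
      simp only [hF.extD_openBookTangent hH s hz, hF.coeffForm_openBookTangent s hz, hk]
      have hpos := hcontact s z (ball_subset_closedBall hz)
      intro h0
      refine mul_ne_zero (mul_ne_zero two_ne_zero hpos.ne') hd ?_
      rw [← h0]
      simp only [areaForm, tripleDet, liouvilleForm]
      ring

/-- Away from the binding the Reeb field is proportional to `∂_s + X_s`. -/
theorem isReebVector_openBookTangent (hF : IsContactCoeff H h F) (hH : IsPeriodicHamiltonian H)
    (s : ℝ) {z : ℂ} (hz : z ∈ ball (0 : ℂ) 1) {a : ℝ × ℂ}
    (ha : IsReebVector (coeffForm F) (openBookMap h s z) (openBookTangent h s z a)) :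
    a.1 * reebDenominator H s z = 1 ∧ a.2 = a.1 • hamiltonianField H s z := by
  obtain ⟨-, h1, h2⟩ := ha
  obtain ⟨k, hk⟩ := fderiv_uncurry_eq hH s hz
  -- Contracting `dα` with vectors tangent to the page determines the direction. The normalisation
  -- `α(R) = 1` then fixes the speed.
  have h3 : a.2 = a.1 • hamiltonianField H s z := by
    refine eq_of_forall_areaForm_eq fun w => ?_
    have := h2 _ (isTangent_openBookTangent h s hz (0, w))
    rw [hF.extD_openBookTangent hH s hz, hk, hk] at this
    simp only [areaForm, Complex.real_smul, Complex.re_ofReal_mul, Complex.im_ofReal_mul] at this ⊢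
    linear_combination this
  refine ⟨?_, h3⟩
  rw [hF.coeffForm_openBookTangent s hz, h3] at h1
  rw [← h1]
  simp only [reebDenominator, liouvilleForm, Complex.real_smul, Complex.re_ofReal_mul,
    Complex.im_ofReal_mul]
  ring

/-- Along the binding the Reeb field is `∂_{θ₁}`. -/
theorem eq_of_isReebVector_of_snd_eq_zero (hF : IsContactCoeff H h F) {x v : ℂ × ℂ}
    (hx : x ∈ sphereThree) (hx2 : x.2 = 0) (hv : IsReebVector (coeffForm F) x v) :
    v = (Complex.I * x.1, 0) := by
  obtain ⟨a, rfl⟩ := exists_eq_bindingTangent hx hx2 hv.1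
  have h1 := hv.2.1
  rw [coeffForm_bindingTangent hx hx2] at h1
  have h2 : a.2 = 0 := by
    refine eq_of_forall_areaForm_eq fun w => ?_
    have ht : IsTangent x (bindingTangent x (0, w)) := by
      simp [IsTangent, bindingTangent, hx2]
    have := hv.2.2 _ ht
    rw [hF.extD_bindingTangent hx hx2, mul_eq_zero,
      or_iff_right (hF.pos_on_binding x hx hx2).ne'] at this
    rw [this]
    simp [areaForm]
  simp [bindingTangent, h1, h2]

end IsContactCoeff

/-! ### The Reeb field of a contact form on the sphere -/

/-- The first vector field of the standard global frame of the tangent bundle of `S³`. -/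
def sphereFrame₁ (x : ℂ × ℂ) : ℂ × ℂ := (Complex.I * x.1, Complex.I * x.2)

/-- The second vector field of the standard frame. -/
def sphereFrame₂ (x : ℂ × ℂ) : ℂ × ℂ := (-Complex.conjCLE x.2, Complex.conjCLE x.1)

/-- The third vector field of the standard frame. -/
def sphereFrame₃ (x : ℂ × ℂ) : ℂ × ℂ :=
  (-(Complex.I * Complex.conjCLE x.2), Complex.I * Complex.conjCLE x.1)

theorem contDiff_sphereFrame₁ {n : WithTop ℕ∞} : ContDiff ℝ n sphereFrame₁ :=
  (contDiff_const.mul contDiff_fst).prodMk (contDiff_const.mul contDiff_snd)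

theorem contDiff_sphereFrame₂ {n : WithTop ℕ∞} : ContDiff ℝ n sphereFrame₂ :=
  (Complex.conjCLE.contDiff.comp contDiff_snd).neg.prodMk
    (Complex.conjCLE.contDiff.comp contDiff_fst)

theorem contDiff_sphereFrame₃ {n : WithTop ℕ∞} : ContDiff ℝ n sphereFrame₃ :=
  (contDiff_const.mul (Complex.conjCLE.contDiff.comp contDiff_snd)).neg.prodMk
    (contDiff_const.mul (Complex.conjCLE.contDiff.comp contDiff_fst))

theorem isTangent_iff (x v : ℂ × ℂ) : IsTangent x v ↔
    x.1.re * v.1.re + x.1.im * v.1.im + (x.2.re * v.2.re + x.2.im * v.2.im) = 0 := by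
  rw [IsTangent, complex_inner_eq, complex_inner_eq]

/-- The combination of the standard frame with the given coefficients. -/
def frameComb (x : ℂ × ℂ) (c₁ c₂ c₃ : ℝ) : ℂ × ℂ :=
  c₁ • sphereFrame₁ x + c₂ • sphereFrame₂ x + c₃ • sphereFrame₃ x

theorem isTangent_frameComb (x : ℂ × ℂ) (c₁ c₂ c₃ : ℝ) : IsTangent x (frameComb x c₁ c₂ c₃) := by
  rw [isTangent_iff]
  simp [frameComb, sphereFrame₁, sphereFrame₂, sphereFrame₃]
  ring

theorem sphere_eq {x : ℂ × ℂ} (hx : x ∈ sphereThree) :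
    x.1.re ^ 2 + x.1.im ^ 2 + (x.2.re ^ 2 + x.2.im ^ 2) = 1 := by
  rw [← complex_norm_sq, ← complex_norm_sq]; exact hx

/-- The frame consists of the products of `x` with three quaternion units and is orthonormal on the
sphere, so the coefficients are the inner products of `v` with it. -/
theorem exists_eq_frameComb {x v : ℂ × ℂ} (hx : x ∈ sphereThree) (hv : IsTangent x v) :
    ∃ c₁ c₂ c₃, v = frameComb x c₁ c₂ c₃ := by
  have h1 := sphere_eq hx
  rw [isTangent_iff] at hv
  refine ⟨-x.1.im * v.1.re + x.1.re * v.1.im - x.2.im * v.2.re + x.2.re * v.2.im,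
    -x.2.re * v.1.re + x.2.im * v.1.im + x.1.re * v.2.re - x.1.im * v.2.im,
    -x.2.im * v.1.re - x.2.re * v.1.im + x.1.im * v.2.re + x.1.re * v.2.im,
    Prod.ext (Complex.ext ?_ ?_) (Complex.ext ?_ ?_)⟩ <;>
  simp [frameComb, sphereFrame₁, sphereFrame₂, sphereFrame₃]
  · linear_combination -v.1.re * h1 + x.1.re * hv
  · linear_combination -v.1.im * h1 + x.1.im * hv
  · linear_combination -v.2.re * h1 + x.2.re * hv
  · linear_combination -v.2.im * h1 + x.2.im * hv

theorem linearIndependent_sphereFrame {x : ℂ × ℂ} (hx : x ∈ sphereThree) :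
    LinearIndependent ℝ ![sphereFrame₁ x, sphereFrame₂ x, sphereFrame₃ x] := by
  have h1 := sphere_eq hx
  rw [Fintype.linearIndependent_iff]
  intro g hg
  simp only [Fin.sum_univ_three, Matrix.cons_val_zero, Matrix.cons_val_one,
    Matrix.cons_val] at hg
  have e1 := congrArg (fun v : ℂ × ℂ => v.1.re) hg
  have e2 := congrArg (fun v : ℂ × ℂ => v.1.im) hg
  have e3 := congrArg (fun v : ℂ × ℂ => v.2.re) hg
  have e4 := congrArg (fun v : ℂ × ℂ => v.2.im) hg
  simp [sphereFrame₁, sphereFrame₂, sphereFrame₃] at e1 e2 e3 e4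
  intro i
  fin_cases i
  · change g 0 = 0
    linear_combination -g 0 * h1 - x.1.im * e1 + x.1.re * e2 - x.2.im * e3 + x.2.re * e4
  · change g 1 = 0
    linear_combination -g 1 * h1 - x.2.re * e1 + x.2.im * e2 + x.1.re * e3 - x.1.im * e4
  · change g 2 = 0
    linear_combination -g 2 * h1 - x.2.im * e1 - x.2.re * e2 + x.1.im * e3 + x.1.re * e4

section

variable (α : ℂ × ℂ → (ℂ × ℂ) →L[ℝ] ℝ)

/-- The first coefficient of the kernel of `dα` with respect to the standard frame. -/
def kernelCoeff₁ (x : ℂ × ℂ) : ℝ := extD α x (sphereFrame₂ x) (sphereFrame₃ x)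

/-- The second coefficient of the kernel of `dα`. -/
def kernelCoeff₂ (x : ℂ × ℂ) : ℝ := extD α x (sphereFrame₃ x) (sphereFrame₁ x)

/-- The third coefficient of the kernel of `dα`. -/
def kernelCoeff₃ (x : ℂ × ℂ) : ℝ := extD α x (sphereFrame₁ x) (sphereFrame₂ x)

/-- The value of `α ∧ dα` on the standard frame. -/
def frameVolume (x : ℂ × ℂ) : ℝ :=
  α x (sphereFrame₁ x) * kernelCoeff₁ α x + α x (sphereFrame₂ x) * kernelCoeff₂ α x +
    α x (sphereFrame₃ x) * kernelCoeff₃ α x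

/-- The Reeb vector field of a contact form. -/
def reebField (x : ℂ × ℂ) : ℂ × ℂ :=
  (frameVolume α x)⁻¹ • frameComb x (kernelCoeff₁ α x) (kernelCoeff₂ α x) (kernelCoeff₃ α x)

variable {α}

theorem isTangent_smul {x v : ℂ × ℂ} (c : ℝ) (hv : IsTangent x v) : IsTangent x (c • v) := by
  rw [isTangent_iff] at *
  simp
  linear_combination c * hv

theorem frameVolume_ne_zero (hα : IsContactForm α) {x : ℂ × ℂ} (hx : x ∈ sphereThree) :
    frameVolume α x ≠ 0 := by
  have e1 : sphereFrame₁ x = frameComb x 1 0 0 := by simp [frameComb]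
  have e2 : sphereFrame₂ x = frameComb x 0 1 0 := by simp [frameComb]
  have e3 : sphereFrame₃ x = frameComb x 0 0 1 := by simp [frameComb]
  exact hα.nondegenerate x hx _ _ _ (by rw [e1]; exact isTangent_frameComb x _ _ _)
    (by rw [e2]; exact isTangent_frameComb x _ _ _)
    (by rw [e3]; exact isTangent_frameComb x _ _ _) (linearIndependent_sphereFrame hx)

/-- In dimension three a 2-form `β` is annihilated by `β(e₂,e₃) e₁ + β(e₃,e₁) e₂ + β(e₁,e₂) e₃`, by
antisymmetry. For `β = dα` the form `α` takes on this vector the value `(α ∧ dα)(e₁,e₂,e₃) ≠ 0`, by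
which one divides. The explicit formula also gives smoothness. -/
theorem isReebVector_reebField (hα : IsContactForm α) {x : ℂ × ℂ} (hx : x ∈ sphereThree) :
    IsReebVector α x (reebField α x) := by
  have h0 := frameVolume_ne_zero hα hx
  refine ⟨isTangent_smul _ (isTangent_frameComb x _ _ _), ?_, fun w hw => ?_⟩
  · have : α x (reebField α x) = (frameVolume α x)⁻¹ * frameVolume α x := by
      simp only [reebField, frameComb, map_smul, map_add, smul_eq_mul, frameVolume]
      ring
    rw [this, inv_mul_cancel₀ h0]
  · obtain ⟨c₁, c₂, c₃, rfl⟩ := exists_eq_frameComb hx hw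
    simp only [reebField, frameComb, extD, map_smul, map_add, smul_eq_mul, kernelCoeff₁,
      kernelCoeff₂, kernelCoeff₃, add_apply, smul_apply]
    ring

theorem contDiffAt_reebField (hα : IsContactForm α) {x : ℂ × ℂ} (hx : x ∈ sphereThree) :
    ContDiffAt ℝ ∞ (reebField α) x := by
  have h0 := hα.smooth x hx
  have hd : ContDiffAt ℝ ∞ (fderiv ℝ α) x := h0.fderiv_right (m := ∞) (by norm_cast)
  have f1 := (contDiff_sphereFrame₁ (n := ∞)).contDiffAt (x := x)
  have f2 := (contDiff_sphereFrame₂ (n := ∞)).contDiffAt (x := x)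
  have f3 := (contDiff_sphereFrame₃ (n := ∞)).contDiffAt (x := x)
  have hext : ∀ {u v : ℂ × ℂ → ℂ × ℂ}, ContDiffAt ℝ ∞ u x → ContDiffAt ℝ ∞ v x →
      ContDiffAt ℝ ∞ (fun y => extD α y (u y) (v y)) x := fun hu hv =>
    ((hd.clm_apply hu).clm_apply hv).sub ((hd.clm_apply hv).clm_apply hu)
  have k1 : ContDiffAt ℝ ∞ (kernelCoeff₁ α) x := hext f2 f3
  have k2 : ContDiffAt ℝ ∞ (kernelCoeff₂ α) x := hext f3 f1
  have k3 : ContDiffAt ℝ ∞ (kernelCoeff₃ α) x := hext f1 f2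
  have hv : ContDiffAt ℝ ∞ (frameVolume α) x :=
    (((h0.clm_apply f1).mul k1).add ((h0.clm_apply f2).mul k2)).add ((h0.clm_apply f3).mul k3)
  exact (hv.inv (frameVolume_ne_zero hα hx)).smul
    (((k1.smul f1).add (k2.smul f2)).add (k3.smul f3))

/-- A smooth cutoff function of the squared radius, equal to `1` on the unit sphere. -/
def radialBump : ContDiffBump (1 : ℝ) := ⟨1 / 4, 1 / 2, by norm_num, by norm_num⟩

/-- A compactly supported extension of the Reeb field to `ℂ²`. -/
def extendedReebField (α : ℂ × ℂ → (ℂ × ℂ) →L[ℝ] ℝ) (x : ℂ × ℂ) : ℂ × ℂ :=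
  radialBump (‖x.1‖ ^ 2 + ‖x.2‖ ^ 2) • reebField α (radialProj x)

theorem extendedReebField_eq {x : ℂ × ℂ} (hx : x ∈ sphereThree) :
    extendedReebField α x = reebField α x := by
  have h1 : ‖x.1‖ ^ 2 + ‖x.2‖ ^ 2 = 1 := hx
  rw [extendedReebField, radialProj_eq_self hx, h1, radialBump.one_of_mem_closedBall
    (mem_closedBall_self radialBump.rIn_pos.le), one_smul]

theorem extendedReebField_eq_zero {x : ℂ × ℂ}
    (hx : 1 / 2 ≤ |‖x.1‖ ^ 2 + ‖x.2‖ ^ 2 - 1|) : extendedReebField α x = 0 := by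
  rw [extendedReebField, radialBump.zero_of_le_dist (by rwa [Real.dist_eq]), zero_smul]

theorem contDiff_extendedReebField (hα : IsContactForm α) :
    ContDiff ℝ ∞ (extendedReebField α) := by
  rw [contDiff_iff_contDiffAt]
  intro x
  -- The radial projection is singular at the origin, but the cutoff vanishes where the squared
  -- radius is below `1/2`.
  rcases eq_or_ne x 0 with rfl | hx
  · refine (contDiffAt_const (c := (0 : ℂ × ℂ))).congr_of_eventuallyEq ?_
    have hc : ContinuousAt (fun x : ℂ × ℂ => ‖x.1‖ ^ 2 + ‖x.2‖ ^ 2) 0 :=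
      (contDiff_normSq (n := 0)).continuous.continuousAt
    filter_upwards [hc.eventually_lt (continuousAt_const (y := (1 / 2 : ℝ))) (by simp)] with y hy
    refine extendedReebField_eq_zero ?_
    rw [abs_of_nonpos (by linarith)]
    linarith
  · exact (radialBump.contDiff.contDiffAt.comp x contDiff_normSq.contDiffAt).smul
      ((contDiffAt_reebField hα (radialProj_mem hx)).comp x (contDiffAt_radialProj hx))

theorem hasCompactSupport_extendedReebField : HasCompactSupport (extendedReebField α) := by
  refine HasCompactSupport.intro (isCompact_closedBall 0 2) fun x hx => ?_
  refine extendedReebField_eq_zero ?_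
  rw [mem_closedBall_zero_iff, not_le, Prod.norm_def, lt_max_iff] at hx
  refine le_trans ?_ (le_abs_self _)
  rcases hx with hx | hx <;> nlinarith [sq_nonneg ‖x.1‖, sq_nonneg ‖x.2‖]

/-- The vector at `x` is a multiple of a vector tangent at the projected point, which is a multiple
of `x`. The extended field is thus tangent to every concentric sphere, so its flow preserves `S³`.
-/
theorem isTangent_extendedReebField (x : ℂ × ℂ) : IsTangent x (extendedReebField α x) := by
  rcases eq_or_ne x 0 with rfl | hx
  · simp [IsTangent]
  have h1 : IsTangent (radialProj x) (reebField α (radialProj x)) :=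
    isTangent_smul _ (isTangent_frameComb _ _ _ _)
  refine isTangent_smul _ ?_
  have h2 := (inv_pos.2 (Real.sqrt_pos.2 (normSq_pos hx))).ne'
  rw [IsTangent] at *
  generalize reebField α (radialProj x) = w at *
  simp only [radialProj, Prod.smul_fst, Prod.smul_snd, real_inner_smul_left] at h1
  rw [← mul_add] at h1
  exact (mul_eq_zero.1 h1).resolve_left h2

/-- The Reeb field of a contact form on `S³` extends to a Lipschitz field on `ℂ²`, and its flow is
complete. -/
theorem exists_reebFlow (hα : IsContactForm α) :
    ∃ (W : ℂ × ℂ → ℂ × ℂ) (K : NNReal) (Fl : ℝ → ℂ × ℂ → ℂ × ℂ), LipschitzWith K W ∧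
      (∀ x ∈ sphereThree, IsReebVector α x (W x)) ∧
      ∀ x ∈ sphereThree, Fl 0 x = x ∧
        ∀ t, Fl t x ∈ sphereThree ∧ HasDerivAt (fun τ => Fl τ x) (W (Fl t x)) t := by
  have hs := contDiff_extendedReebField hα
  have hc := hasCompactSupport_extendedReebField (α := α)
  obtain ⟨K, hK⟩ := hs.lipschitzWith_of_hasCompactSupport hc (by simp)
  obtain ⟨L, hL⟩ := hc.exists_bound_of_continuous hs.continuous
  have hflow := exists_integralCurve_of_lipschitz_bounded hK (L := L.toNNReal)
    (fun x => (hL x).trans (Real.le_coe_toNNReal L))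
  choose γ hγ0 hγ using hflow
  refine ⟨extendedReebField α, K, fun t x => γ x t, hK, fun x hx => ?_, fun x hx =>
    ⟨hγ0 x, fun t => ⟨?_, hγ x t⟩⟩⟩
  · rw [extendedReebField_eq hx]; exact isReebVector_reebField hα hx
  · have hd : ∀ t, HasDerivAt (fun τ => ‖(γ x τ).1‖ ^ 2 + ‖(γ x τ).2‖ ^ 2) 0 t := by
      intro t
      have h1 : HasDerivAt (fun τ => (γ x τ).1) _ t := (hγ x t).fst
      have h2 : HasDerivAt (fun τ => (γ x τ).2) _ t := (hγ x t).snd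
      refine (h1.norm_sq.add h2.norm_sq).congr_deriv ?_
      have := isTangent_extendedReebField (α := α) (γ x t)
      rw [IsTangent] at this
      rw [← mul_add, this, mul_zero]
    have := is_const_of_deriv_eq_zero (fun t => (hd t).differentiableAt)
      (fun t => (hd t).deriv) t 0
    change ‖(γ x t).1‖ ^ 2 + ‖(γ x t).2‖ ^ 2 = 1
    rw [this, hγ0]
    exact hx

end

/-! ### Bounds for the Hamiltonian vector field -/

namespace IsPeriodicHamiltonian

variable {H : ℝ → ℂ → ℝ}

theorem uniqueDiffOn_cylinder : UniqueDiffOn ℝ ((univ : Set ℝ) ×ˢ disc) :=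
  uniqueDiffOn_univ.prod uniqueDiffOn_disc

theorem spatialDeriv_eq_fderivWithin (hH : IsPeriodicHamiltonian H) (s : ℝ) {z : ℂ}
    (hz : z ∈ disc) (ζ : ℂ) :
    spatialDeriv H s z ζ = fderivWithin ℝ (uncurry H) (univ ×ˢ disc) (s, z) (0, ζ) := by
  have h1 : HasFDerivWithinAt (uncurry H) (fderivWithin ℝ (uncurry H) (univ ×ˢ disc) (s, z))
      (univ ×ˢ disc) (s, z) :=
    ((hH.smooth.differentiableOn (by simp)) (s, z) ⟨mem_univ _, hz⟩).hasFDerivWithinAt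
  have h2 : HasFDerivWithinAt (H s) _ disc z :=
    h1.comp z (f := fun w => (s, w))
      ((hasFDerivWithinAt_const s z disc).prodMk (hasFDerivWithinAt_id z disc))
      (fun w hw => ⟨mem_univ _, hw⟩)
  rw [spatialDeriv, h2.fderivWithin (uniqueDiffOn_disc z hz)]
  simp

theorem contDiffOn_hamiltonianField (hH : IsPeriodicHamiltonian H) :
    ContDiffOn ℝ ∞ (uncurry (hamiltonianField H)) (univ ×ˢ disc) := by
  have h1 : ContDiffOn ℝ ∞ (fderivWithin ℝ (uncurry H) (univ ×ˢ disc)) (univ ×ˢ disc) :=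
    hH.smooth.fderivWithin uniqueDiffOn_cylinder (by norm_cast)
  have h2 : ∀ ζ : ℂ, ContDiffOn ℝ ∞ (fun p : ℝ × ℂ => spatialDeriv H p.1 p.2 ζ)
      (univ ×ˢ disc) := fun ζ =>
    (h1.clm_apply contDiffOn_const).congr fun p hp => hH.spatialDeriv_eq_fderivWithin _ hp.2 ζ
  have h3 : ContDiffOn ℝ ∞ (fun p : ℝ × ℂ => ((spatialDeriv H p.1 p.2 Complex.I / 2 : ℝ) : ℂ) +
      ((-(spatialDeriv H p.1 p.2 1) / 2 : ℝ) : ℂ) * Complex.I) (univ ×ˢ disc) :=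
    (Complex.ofRealCLM.contDiff.comp_contDiffOn ((h2 _).div_const 2)).add
      ((Complex.ofRealCLM.contDiff.comp_contDiffOn ((h2 _).neg.div_const 2)).mul contDiffOn_const)
  refine h3.congr fun p _ => ?_
  simp only [uncurry, hamiltonianField, Complex.mk_eq_add_mul_I]

theorem hamiltonianField_periodic_int (hH : IsPeriodicHamiltonian H) (k : ℤ) (s : ℝ) {z : ℂ}
    (hz : z ∈ disc) :
    hamiltonianField H (s + k * (2 * Real.pi)) z = hamiltonianField H s z := by
  have : spatialDeriv H (s + k * (2 * Real.pi)) z = spatialDeriv H s z :=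
    fderivWithin_congr (fun w hw => hH.periodic_int k s hw) (hH.periodic_int k s hz)
  rw [hamiltonianField, this, hamiltonianField]

/-- On a bounded time interval the Hamiltonian vector fields are uniformly Lipschitz. -/
theorem exists_lipschitzOnWith_hamiltonianField (hH : IsPeriodicHamiltonian H) (a b : ℝ) :
    ∃ K : NNReal, ∀ s ∈ Icc a b, LipschitzOnWith K (hamiltonianField H s) disc := by
  obtain ⟨K, hK⟩ := (hH.contDiffOn_hamiltonianField.mono
    (prod_mono (subset_univ (Icc a b)) Subset.rfl)).exists_lipschitzOnWith (by simp)
    ((convex_Icc a b).prod (convex_closedBall 0 1))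
    (isCompact_Icc.prod (isCompact_closedBall 0 1))
  refine ⟨K, fun s hs => LipschitzOnWith.of_dist_le_mul fun z hz w hw => ?_⟩
  have := hK.dist_le_mul (s, z) ⟨hs, hz⟩ (s, w) ⟨hs, hw⟩
  simpa [uncurry, Prod.dist_eq] using this

/-- Compactness of one period times the disc, extended to all times by periodicity. The lower bound
controls the Lipschitz constant of the time-changed field. The upper bound keeps the angular speed
away from zero, so that every page is reached. -/
theorem exists_bounds_reebDenominator (hH : IsPeriodicHamiltonian H)
    (hcontact : ContactCondition H) :
    ∃ m M : ℝ, 0 < m ∧ ∀ s, ∀ z ∈ disc, m ≤ reebDenominator H s z ∧ reebDenominator H s z ≤ M := by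
  have hcont : ContinuousOn (uncurry (reebDenominator H)) (univ ×ˢ disc) := by
    have h1 := hH.contDiffOn_hamiltonianField.continuousOn
    have hre : ContinuousOn (fun p : ℝ × ℂ => p.2.re * (uncurry (hamiltonianField H) p).im -
        p.2.im * (uncurry (hamiltonianField H) p).re) (univ ×ˢ disc) :=
      ((Complex.continuous_re.comp continuous_snd).continuousOn.mul
        (Complex.continuous_im.comp_continuousOn h1)).sub
      ((Complex.continuous_im.comp continuous_snd).continuousOn.mul
        (Complex.continuous_re.comp_continuousOn h1))
    exact hH.smooth.continuousOn.add hre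
  have hc : IsCompact (Icc 0 (2 * Real.pi) ×ˢ disc) := isCompact_Icc.prod (isCompact_closedBall 0 1)
  have hcK := hcont.mono (prod_mono (subset_univ (Icc 0 (2 * Real.pi))) Subset.rfl)
  have hne : (Icc 0 (2 * Real.pi) ×ˢ disc).Nonempty :=
    ⟨(0, 0), ⟨le_rfl, by positivity⟩, by simp [disc]⟩
  obtain ⟨p, hp, hpmin⟩ := hc.exists_isMinOn hne hcK
  obtain ⟨q, hq, hqmax⟩ := hc.exists_isMaxOn hne hcK
  refine ⟨uncurry (reebDenominator H) p, uncurry (reebDenominator H) q,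
    hcontact p.1 p.2 hp.2, fun s z hz => ?_⟩
  obtain ⟨s', hs', hs⟩ : ∃ s' ∈ Icc 0 (2 * Real.pi), reebDenominator H s z =
      reebDenominator H s' z := by
    refine ⟨toIcoMod Real.two_pi_pos 0 s, ?_, ?_⟩
    · have := toIcoMod_mem_Ico Real.two_pi_pos 0 s
      rw [zero_add] at this
      exact Ico_subset_Icc_self this
    · have h1 : s = toIcoMod Real.two_pi_pos 0 s +
          (toIcoDiv Real.two_pi_pos 0 s : ℤ) * (2 * Real.pi) := by
        rw [← zsmul_eq_mul, toIcoMod_add_toIcoDiv_zsmul]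
      conv_lhs => rw [h1]
      rw [reebDenominator, hH.periodic_int _ _ hz, hH.hamiltonianField_periodic_int _ _ hz,
        reebDenominator]
  rw [hs]
  exact ⟨hpmin (show (s', z) ∈ _ from ⟨hs', hz⟩), hqmax (show (s', z) ∈ _ from ⟨hs', hz⟩)⟩

end IsPeriodicHamiltonian

/-! ### Orbits of the Reeb flow -/

/-- `Fl` is the complete flow on `S³` of a Lipschitz field extending the Reeb field of the contact
form with coefficient `F`. -/
structure IsLipschitzReebFlow (F : ℂ × ℂ → ℝ) (W : ℂ × ℂ → ℂ × ℂ) (K : NNReal)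
    (Fl : ℝ → ℂ × ℂ → ℂ × ℂ) : Prop where
  lipschitz : LipschitzWith K W
  reeb : ∀ x ∈ sphereThree, IsReebVector (coeffForm F) x (W x)
  flow : ∀ x ∈ sphereThree, Fl 0 x = x ∧
    ∀ t, Fl t x ∈ sphereThree ∧ HasDerivAt (fun τ => Fl τ x) (W (Fl t x)) t

namespace IsLipschitzReebFlow

variable {H : ℝ → ℂ → ℝ} {h : ℕ} {F : ℂ × ℂ → ℝ} {W : ℂ × ℂ → ℂ × ℂ} {K : NNReal}
  {Fl : ℝ → ℂ × ℂ → ℂ × ℂ}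

theorem isReebFlow (hFl : IsLipschitzReebFlow F W K Fl) : IsReebFlow (coeffForm F) Fl :=
  fun x hx => ⟨(hFl.flow x hx).1, fun t => ⟨((hFl.flow x hx).2 t).1, W (Fl t x),
    hFl.reeb _ ((hFl.flow x hx).2 t).1, ((hFl.flow x hx).2 t).2⟩⟩

/-- Orbits that meet the binding stay in it and rotate at unit speed. -/
theorem eq_of_snd_eq_zero (hFl : IsLipschitzReebFlow F W K Fl) (hF : IsContactCoeff H h F)
    {x : ℂ × ℂ} (hx : x ∈ sphereThree) {t₀ : ℝ} (h0 : (Fl t₀ x).2 = 0) (t : ℝ) :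
    Fl t x = (Complex.exp ((t - t₀ : ℝ) * Complex.I) * (Fl t₀ x).1, 0) := by
  set y := Fl t₀ x with hy
  have hyS : y ∈ sphereThree := ((hFl.flow x hx).2 t₀).1
  have hg : ∀ t : ℝ, ((Complex.exp ((t - t₀ : ℝ) * Complex.I) * y.1, 0) : ℂ × ℂ) ∈
      sphereThree := by
    intro t
    have : ‖y.1‖ ^ 2 + ‖y.2‖ ^ 2 = 1 := hyS
    simp only [sphereThree, mem_ofPred_eq, norm_mul, norm_exp_mul_I, one_mul]
    rw [← this, h0]
  have hgd : ∀ t : ℝ, HasDerivAt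
      (fun t : ℝ => ((Complex.exp ((t - t₀ : ℝ) * Complex.I) * y.1, 0) : ℂ × ℂ))
      (W (Complex.exp ((t - t₀ : ℝ) * Complex.I) * y.1, 0)) t := by
    intro t
    rw [hF.eq_of_isReebVector_of_snd_eq_zero (hg t) rfl (hFl.reeb _ (hg t))]
    have h1 : HasDerivAt (fun t : ℝ => ((t - t₀ : ℝ) : ℂ) * Complex.I)
        (((1 : ℝ) : ℂ) * Complex.I) t :=
      (((hasDerivAt_id t).sub_const t₀).ofReal_comp).mul_const _
    refine ((h1.cexp.mul_const y.1).prodMk (hasDerivAt_const t (0 : ℂ))).congr_deriv ?_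
    ext <;> (simp; try ring)
  have := ODE_solution_unique_univ (v := fun _ => W) (s := fun _ => univ) (t₀ := t₀) (K := K)
    (fun _ => hFl.lipschitz.lipschitzOnWith)
    (fun t => ⟨((hFl.flow x hx).2 t).2, mem_univ _⟩) (fun t => ⟨hgd t, mem_univ _⟩)
    (Prod.ext (by simp [hy]) h0)
  exact congrFun this t

theorem snd_ne_zero (hFl : IsLipschitzReebFlow F W K Fl) (hF : IsContactCoeff H h F)
    {x : ℂ × ℂ} (hx : x ∈ sphereThree) (hx2 : x.2 ≠ 0) (t : ℝ) : (Fl t x).2 ≠ 0 := by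
  intro h0
  have h1 := hFl.eq_of_snd_eq_zero hF hx h0 0
  rw [(hFl.flow x hx).1] at h1
  exact hx2 (by rw [h1])

/-- Away from the binding a Reeb orbit is a reparametrised orbit of `∂_s + X_s`. -/
theorem exists_lift (hFl : IsLipschitzReebFlow F W K Fl) (hF : IsContactCoeff H h F)
    (hH : IsPeriodicHamiltonian H) (s₀ : ℝ) {z₀ : ℂ} (hz₀ : z₀ ∈ ball (0 : ℂ) 1) :
    ∃ (s : ℝ → ℝ) (z : ℝ → ℂ), s 0 = s₀ ∧ z 0 = z₀ ∧ ∀ t, z t ∈ ball (0 : ℂ) 1 ∧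
      Fl t (openBookMap h s₀ z₀) = openBookMap h (s t) (z t) ∧
      HasDerivAt s (reebDenominator H (s t) (z t))⁻¹ t ∧
      HasDerivAt z ((reebDenominator H (s t) (z t))⁻¹ • hamiltonianField H (s t) (z t)) t := by
  set x := openBookMap h s₀ z₀ with hxdef
  have hx : x ∈ sphereThree := openBookMap_mem h s₀ (ball_subset_closedBall hz₀)
  have hx2 : x.2 ≠ 0 := openBookMap_snd_ne_zero h s₀ hz₀
  set y : ℝ → ℂ × ℂ := fun t => Fl t x with hy
  have hyS : ∀ t, y t ∈ sphereThree := fun t => ((hFl.flow x hx).2 t).1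
  have hyd : ∀ t, HasDerivAt y (W (y t)) t := fun t => ((hFl.flow x hx).2 t).2
  have hy0 : y 0 = x := (hFl.flow x hx).1
  have hy2 : ∀ t, (y t).2 ≠ 0 := hFl.snd_ne_zero hF hx hx2
  have hyc : Continuous y := continuous_iff_continuousAt.2 fun t => (hyd t).continuousAt
  -- Integrating the logarithmic derivative of the second coordinate gives a continuous branch of
  -- its logarithm along the orbit, whose imaginary part lifts the angle to `ℝ`.
  set ℓ : ℝ → ℂ := fun t => (W (y t)).2 / (y t).2 with hℓ
  have hℓc : Continuous ℓ := (hFl.lipschitz.continuous.comp hyc).snd.div hyc.snd hy2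
  set κ : ℝ → ℂ := fun t => ∫ τ in (0 : ℝ)..t, ℓ τ with hκ
  have hκd : ∀ t, HasDerivAt κ (ℓ t) t := fun t =>
    (hℓc.integral_hasStrictDerivAt 0 t).hasDerivAt
  have hκ0 : κ 0 = 0 := by simp [hκ]
  have hconst : ∀ t, (y t).2 = x.2 * Complex.exp (κ t) := by
    have hd : ∀ t, HasDerivAt (fun t => (y t).2 * Complex.exp (-κ t)) 0 t := by
      intro t
      have hsnd : HasDerivAt (fun t => (y t).2) (W (y t)).2 t := (hyd t).snd
      refine (hsnd.mul (hκd t).neg.cexp).congr_deriv ?_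
      have := hy2 t
      simp only [hℓ]
      field_simp
      ring
    intro t
    have := is_const_of_deriv_eq_zero (fun t => (hd t).differentiableAt)
      (fun t => (hd t).deriv) t 0
    simp only [hκ0, neg_zero, Complex.exp_zero, mul_one, hy0] at this
    rw [← this, mul_assoc, ← Complex.exp_add, neg_add_cancel, Complex.exp_zero, mul_one]
  set s : ℝ → ℝ := fun t => s₀ + (κ t).im with hs
  have hsd : ∀ t, HasDerivAt s (ℓ t).im t := fun t =>
    ((Complex.imCLM.hasFDerivAt.comp_hasDerivAt t (hκd t))).const_add s₀
  set z : ℝ → ℂ := fun t => (y t).1 * Complex.exp (((-(h * s t) : ℝ) : ℂ) * Complex.I) with hz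
  have hnz : ∀ t, ‖z t‖ = ‖(y t).1‖ := fun t => by
    simp only [hz, norm_mul, norm_exp_mul_I, mul_one]
  have hzmem : ∀ t, z t ∈ ball (0 : ℂ) 1 := by
    intro t
    rw [mem_ball_zero_iff, hnz]
    have h1 : ‖(y t).1‖ ^ 2 + ‖(y t).2‖ ^ 2 = 1 := hyS t
    have h2 := norm_pos_iff.2 (hy2 t)
    nlinarith [norm_nonneg (y t).1]
  have hlift : ∀ t, y t = openBookMap h (s t) (z t) := by
    intro t
    refine Prod.ext ?_ ?_
    · simp only [openBookMap, hz]
      rw [mul_assoc, ← Complex.exp_add, Complex.ofReal_neg, neg_mul, neg_add_cancel,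
        Complex.exp_zero, mul_one]
    · have h1 : ‖(y t).1‖ ^ 2 + ‖(y t).2‖ ^ 2 = 1 := hyS t
      have h2 : (y t).2 = ((√(1 - ‖z₀‖ ^ 2) * Real.exp (κ t).re : ℝ) : ℂ) *
          Complex.exp (s t * Complex.I) := by
        rw [hconst t, hxdef, openBookMap]
        conv_lhs => rw [← Complex.re_add_im (κ t)]
        simp only [hs]
        push_cast
        rw [Complex.exp_add, add_mul, Complex.exp_add]
        ring
      have h3 : ‖(y t).2‖ = √(1 - ‖z₀‖ ^ 2) * Real.exp (κ t).re := by
        rw [h2, norm_mul, norm_exp_mul_I, mul_one, Complex.norm_real, Real.norm_eq_abs,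
          abs_of_nonneg (by positivity)]
      rw [h2, ← h3]
      simp only [openBookMap]
      rw [hnz, ← h1, add_sub_cancel_left, Real.sqrt_sq (norm_nonneg _)]
  -- Mere differentiability suffices: the value of the derivative is read off afterwards from the
  -- characterisation of the Reeb vector.
  have hzd : ∀ t, ∃ ζ, HasDerivAt z ζ t := by
    intro t
    have h1 : HasDerivAt (fun τ => ((-(h * s τ) : ℝ) : ℂ) * Complex.I) _ t :=
      (((hsd t).const_mul (h : ℝ)).neg.ofReal_comp).mul_const _
    have hfst : HasDerivAt (fun t => (y t).1) (W (y t)).1 t := (hyd t).fst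
    exact ⟨_, hfst.mul h1.cexp⟩
  refine ⟨s, z, by simp [hs, hκ0], ?_, fun t => ?_⟩
  · have hs0 : s 0 = s₀ := by simp [hs, hκ0]
    simp only [hz, hy0, hs0, hxdef, openBookMap]
    rw [mul_assoc, ← Complex.exp_add, Complex.ofReal_neg, neg_mul, add_neg_cancel,
      Complex.exp_zero, mul_one]
  · obtain ⟨ζ, hζ⟩ := hzd t
    have h1 := hasDerivAt_openBookMap_comp h (hsd t) hζ (hzmem t)
    have h2 : (fun τ => openBookMap h (s τ) (z τ)) = y := funext fun τ => (hlift τ).symm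
    rw [h2] at h1
    have h3 := h1.unique (hyd t)
    have h4 := hFl.reeb _ (hyS t)
    rw [← h3, hlift t] at h4
    obtain ⟨h5, h6⟩ := hF.isReebVector_openBookTangent hH (s t) (hzmem t) h4
    simp only at h5 h6
    have h7 : (ℓ t).im = (reebDenominator H (s t) (z t))⁻¹ := eq_inv_of_mul_eq_one_left h5
    refine ⟨hzmem t, hlift t, ?_, ?_⟩
    · rw [← h7]; exact hsd t
    · rw [← h7, ← h6]; exact hζ

end IsLipschitzReebFlow

/-! ### Time change -/

theorem strictMono_of_hasDerivAt_inv_pos {s : ℝ → ℝ} {d : ℝ → ℝ}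
    (hs : ∀ t, HasDerivAt s (d t)⁻¹ t) (hd : ∀ t, 0 < d t) : StrictMono s :=
  strictMono_of_deriv_pos fun t => by rw [(hs t).deriv]; exact inv_pos.2 (hd t)

/-- The speed is at least `1/M`, so `s t - t/M` is monotone and `s` is unbounded in both directions.
-/
theorem surjective_of_hasDerivAt_inv_le {s : ℝ → ℝ} {d : ℝ → ℝ} {M : ℝ}
    (hs : ∀ t, HasDerivAt s (d t)⁻¹ t) (hd : ∀ t, 0 < d t) (hM : ∀ t, d t ≤ M) :
    Surjective s := by
  have hM0 : 0 < M := (hd 0).trans_le (hM 0)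
  have hmono : Monotone fun t => s t - t * M⁻¹ := by
    have hder : ∀ t, HasDerivAt (fun t => s t - t * M⁻¹) ((d t)⁻¹ - M⁻¹) t := fun t => by
      have h1 : HasDerivAt (fun t => t * M⁻¹) M⁻¹ t := by
        simpa using (hasDerivAt_id t).mul_const M⁻¹
      exact (hs t).sub h1
    refine monotone_of_deriv_nonneg (fun t => (hder t).differentiableAt) fun t => ?_
    rw [(hder t).deriv, sub_nonneg]
    exact inv_anti₀ (hd t) (hM t)
  have hcont : Continuous s := continuous_iff_continuousAt.2 fun t => (hs t).continuousAt
  refine hcont.surjective ?_ ?_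
  · refine Filter.tendsto_atTop_mono' _ ?_ (Filter.tendsto_atTop_add_const_left _ (s 0)
      (Filter.tendsto_id.atTop_mul_const (inv_pos.2 hM0)))
    filter_upwards [Filter.eventually_ge_atTop 0] with t ht
    have := hmono ht
    simp only [zero_mul, sub_zero] at this
    simp only [id]
    linarith
  · refine Filter.tendsto_atBot_mono' _ ?_ (Filter.tendsto_atBot_add_const_left _ (s 0)
      (Filter.tendsto_id.atBot_mul_const (inv_pos.2 hM0)))
    filter_upwards [Filter.eventually_le_atBot 0] with t ht
    have := hmono ht
    simp only [zero_mul, sub_zero] at this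
    simp only [id]
    linarith

/-- A reparametrised integral curve of the Hamiltonian vector field agrees with the isotopy. -/
theorem eq_isotopy_of_hasDerivAt {H : ℝ → ℂ → ℝ} (hH : IsPeriodicHamiltonian H)
    {φ : ℝ → ℂ → ℂ} (hφ0 : ∀ z ∈ disc, φ 0 z = z)
    (hφ : ∀ s : ℝ, ∀ z ∈ disc, φ s z ∈ disc ∧
      HasDerivAt (fun t => φ t z) (hamiltonianField H s (φ s z)) s)
    {s d : ℝ → ℝ} {z : ℝ → ℂ} (hs0 : s 0 = 0) (hs : ∀ t, HasDerivAt s (d t)⁻¹ t)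
    {m : ℝ} (hm : 0 < m) (hd : ∀ t, m ≤ d t) (hzmem : ∀ t, z t ∈ disc)
    (hz : ∀ t, HasDerivAt z ((d t)⁻¹ • hamiltonianField H (s t) (z t)) t) {T : ℝ} (hT : 0 ≤ T) :
    z T = φ (s T) (z 0) := by
  have hmono := (strictMono_of_hasDerivAt_inv_pos hs fun t => hm.trans_le (hd t)).monotone
  obtain ⟨K, hK⟩ := hH.exists_lipschitzOnWith_hamiltonianField (s 0) (s T)
  have hy : ∀ t, HasDerivAt (fun t => φ (s t) (z 0))
      ((d t)⁻¹ • hamiltonianField H (s t) (φ (s t) (z 0))) t := fun t =>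
    (hφ (s t) (z 0) (hzmem 0)).2.scomp t (hs t)
  -- Both curves solve `w' = d(t)⁻¹ X_{s(t)}(w)` inside the disc with the same initial value. This
  -- field has Lipschitz constant at most `K/m` for `s(t)` in the compact interval `[s 0, s T]`.
  refine ODE_solution_unique_of_mem_Icc_right (a := 0) (b := T) (K := m⁻¹.toNNReal * K)
    (v := fun t w => (d t)⁻¹ • hamiltonianField H (s t) w) (s := fun _ => disc)
    (g := fun t => φ (s t) (z 0)) (fun t ht => ?_)
    (fun t _ => (hz t).continuousAt.continuousWithinAt) (fun t _ => (hz t).hasDerivWithinAt)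
    (fun t _ => hzmem t) (fun t _ => (hy t).continuousAt.continuousWithinAt)
    (fun t _ => (hy t).hasDerivWithinAt) (fun t _ => (hφ (s t) (z 0) (hzmem 0)).1) ?_
    ⟨hT, le_rfl⟩
  · refine LipschitzOnWith.of_dist_le_mul fun w hw w' hw' => ?_
    have h1 := (hK (s t) ⟨hmono ht.1, hmono ht.2.le⟩).dist_le_mul w hw w' hw'
    have h2 : ‖(d t)⁻¹‖ ≤ m⁻¹ := by
      rw [Real.norm_eq_abs, abs_of_pos (inv_pos.2 (hm.trans_le (hd t)))]
      exact inv_anti₀ hm (hd t)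
    rw [dist_smul₀, NNReal.coe_mul, Real.coe_toNNReal _ (inv_pos.2 hm).le, mul_assoc]
    exact mul_le_mul h2 h1 dist_nonneg (inv_pos.2 hm).le
  · simp only [hs0]
    rw [hφ0 _ (hzmem 0)]

/-! ### The page of the open book -/

/-- The page `s = 0`, parametrised as in `S¹ × D²`. -/
def pageMap (z : ℂ) : ℂ × ℂ := (z, (√(1 - ‖z‖ ^ 2) : ℝ))

/-- The page `s = 0`, parametrised smoothly up to the boundary. -/
def smoothPageMap (z : ℂ) : ℂ × ℂ := (z * (√(2 - ‖z‖ ^ 2) : ℝ), ((1 - ‖z‖ ^ 2 : ℝ) : ℂ))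

theorem openBookMap_two_pi_int (h : ℕ) (k : ℤ) (z : ℂ) :
    openBookMap h (k * (2 * Real.pi)) z = pageMap z := by
  have e : ∀ n : ℤ, Complex.exp (((n * (2 * Real.pi) : ℝ) : ℂ) * Complex.I) = 1 := by
    intro n
    rw [Complex.exp_eq_one_iff]
    exact ⟨n, by push_cast; ring⟩
  have e1 := e (h * k)
  rw [openBookMap, e k, show (h : ℝ) * (k * (2 * Real.pi)) = ((h * k : ℤ) : ℝ) * (2 * Real.pi) by
    push_cast; ring, e1, mul_one, mul_one, pageMap]

theorem openBookMap_zero (h : ℕ) (z : ℂ) : openBookMap h 0 z = pageMap z := by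
  simpa using openBookMap_two_pi_int h 0 z

theorem norm_le_one_of_mem_disc {z : ℂ} (hz : z ∈ disc) : ‖z‖ ≤ 1 := by simpa [disc] using hz

/-- The radial substitution `r ↦ r√(2-r²)` makes `1 - r²` a perfect square. It thereby removes the
square-root singularity of `pageMap` at the boundary circle. -/
theorem norm_sq_smooth_reparam {z : ℂ} (hz : z ∈ disc) :
    1 - ‖z * (√(2 - ‖z‖ ^ 2) : ℝ)‖ ^ 2 = (1 - ‖z‖ ^ 2) ^ 2 := by
  have h1 := norm_le_one_of_mem_disc hz
  have h2 : 0 ≤ 2 - ‖z‖ ^ 2 := by nlinarith [norm_nonneg z]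
  rw [norm_mul, mul_pow, Complex.norm_real, Real.norm_eq_abs, sq_abs, Real.sq_sqrt h2]
  ring

theorem smoothPageMap_eq {z : ℂ} (hz : z ∈ disc) :
    smoothPageMap z = pageMap (z * (√(2 - ‖z‖ ^ 2) : ℝ)) := by
  rw [smoothPageMap, pageMap, norm_sq_smooth_reparam hz,
    Real.sqrt_sq (one_sub_sq_nonneg_of_mem_disc hz)]

theorem smooth_reparam_mem_ball {z : ℂ} (hz : z ∈ ball (0 : ℂ) 1) :
    z * (√(2 - ‖z‖ ^ 2) : ℝ) ∈ ball (0 : ℂ) 1 := by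
  have h1 := norm_sq_smooth_reparam (ball_subset_closedBall hz)
  have h2 := pow_pos (one_sub_sq_pos hz) 2
  rw [mem_ball_zero_iff]
  by_contra! h3
  nlinarith

theorem smoothPageMap_mem {z : ℂ} (hz : z ∈ disc) : smoothPageMap z ∈ sphereThree := by
  have h1 := norm_sq_smooth_reparam hz
  simp only [sphereThree, smoothPageMap, mem_ofPred_eq, Complex.norm_real, Real.norm_eq_abs,
    sq_abs]
  linarith

theorem image_pageMap_ball : pageMap '' ball 0 1 = smoothPageMap '' ball 0 1 := by
  ext x
  constructor
  · rintro ⟨w, hw, rfl⟩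
    have h0 := one_sub_sq_pos hw
    set q := √(1 - ‖w‖ ^ 2) with hq
    have hq0 : 0 < q := Real.sqrt_pos.2 h0
    have hqs : q ^ 2 = 1 - ‖w‖ ^ 2 := Real.sq_sqrt h0.le
    have h1q : 0 < √(1 + q) := Real.sqrt_pos.2 (by linarith)
    have hsq : √(1 + q) ^ 2 = 1 + q := Real.sq_sqrt (by linarith)
    have hn : ‖w * ((√(1 + q))⁻¹ : ℝ)‖ ^ 2 = 1 - q := by
      rw [norm_mul, mul_pow, Complex.norm_real, Real.norm_eq_abs, sq_abs, inv_pow, hsq]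
      field_simp
      linarith
    -- This inverts the radial substitution: with `q² = 1 - |w|²` the preimage must satisfy `1 -
    -- |z|² = q`, and `|w|²/(1+q) = 1 - q`.
    refine ⟨w * ((√(1 + q))⁻¹ : ℝ), ?_, ?_⟩
    · rw [mem_ball_zero_iff]
      by_contra! h3
      nlinarith
    · rw [smoothPageMap, hn, pageMap, ← hq, show 2 - (1 - q) = 1 + q by ring, mul_assoc,
        ← Complex.ofReal_mul, inv_mul_cancel₀ h1q.ne', sub_sub_cancel, Complex.ofReal_one, mul_one]
  · rintro ⟨z, hz, rfl⟩
    exact ⟨_, smooth_reparam_mem_ball hz, (smoothPageMap_eq (ball_subset_closedBall hz)).symm⟩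

theorem pageMap_of_mem_sphere {z : ℂ} (hz : z ∈ sphere (0 : ℂ) 1) : pageMap z = (z, 0) := by
  have : ‖z‖ = 1 := by simpa using hz
  simp [pageMap, this]

theorem smoothPageMap_of_mem_sphere {z : ℂ} (hz : z ∈ sphere (0 : ℂ) 1) :
    smoothPageMap z = (z, 0) := by
  have : ‖z‖ = 1 := by simpa using hz
  simp [smoothPageMap, this]
  norm_num

theorem image_smoothPageMap_sphere :
    smoothPageMap '' sphere 0 1 = {x ∈ sphereThree | x.2 = 0} := by
  ext x
  constructor
  · rintro ⟨z, hz, rfl⟩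
    exact ⟨smoothPageMap_mem (sphere_subset_closedBall hz),
      by rw [smoothPageMap_of_mem_sphere hz]⟩
  · rintro ⟨hx, hx2⟩
    have hx' : ‖x.1‖ ^ 2 + ‖x.2‖ ^ 2 = 1 := hx
    have hz : x.1 ∈ sphere (0 : ℂ) 1 := by
      rw [mem_sphere_zero_iff_norm]
      rw [hx2, norm_zero] at hx'
      nlinarith [norm_nonneg x.1]
    exact ⟨x.1, hz, by rw [smoothPageMap_of_mem_sphere hz, ← hx2]⟩

theorem two_sub_sq_pos {z : ℂ} (hz : z ∈ disc) : 0 < 2 - ‖z‖ ^ 2 := by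
  nlinarith [norm_nonneg z, norm_le_one_of_mem_disc hz]

theorem contDiffAt_smoothPageMap {z : ℂ} (hz : z ∈ disc) : ContDiffAt ℝ ∞ smoothPageMap z := by
  have hn : ContDiffAt ℝ ∞ (fun z : ℂ => ‖z‖ ^ 2) z := contDiffAt_id.norm_sq ℝ
  exact (contDiffAt_id.mul (Complex.ofRealCLM.contDiff.contDiffAt.comp z
    ((contDiffAt_const.sub hn).sqrt (two_sub_sq_pos hz).ne'))).prodMk
    (Complex.ofRealCLM.contDiff.contDiffAt.comp z (contDiffAt_const.sub hn))

theorem hasDerivAt_line (z u : ℂ) : HasDerivAt (fun t : ℝ => z + t * u) u 0 := by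
  simpa using (((hasDerivAt_id (0 : ℝ)).ofReal_comp).mul_const u).const_add z

theorem fderiv_apply_eq_of_line {E : Type*} [NormedAddCommGroup E] [NormedSpace ℝ E] {g : ℂ → E}
    {z : ℂ} (hg : DifferentiableAt ℝ g z) {u : ℂ} {v : E}
    (hv : HasDerivAt (fun t : ℝ => g (z + t * u)) v 0) : fderiv ℝ g z u = v := by
  have h1 : HasFDerivAt g (fderiv ℝ g z) ((fun t : ℝ => z + t * u) 0) := by
    simpa using hg.hasFDerivAt
  exact (h1.comp_hasDerivAt (0 : ℝ) (hasDerivAt_line z u)).unique hv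

theorem isSmoothDiscEmbedding_smoothPageMap : IsSmoothDiscEmbedding smoothPageMap where
  smooth z hz := (contDiffAt_smoothPageMap hz).contDiffWithinAt
  mapsTo z hz := smoothPageMap_mem hz
  injOn z hz w hw hzw := by
    have h1 : ‖z‖ ^ 2 = ‖w‖ ^ 2 := by
      have := congrArg (fun x : ℂ × ℂ => x.2.re) hzw
      simp only [smoothPageMap, Complex.ofReal_re] at this
      linarith
    have h2 := congrArg Prod.fst hzw
    simp only [smoothPageMap, h1] at h2
    exact mul_right_cancel₀ (Complex.ofReal_ne_zero.2 (Real.sqrt_pos.2 (two_sub_sq_pos hw)).ne') h2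
  immersion z hz := by
    have hd : DifferentiableAt ℝ smoothPageMap z :=
      (contDiffAt_smoothPageMap hz).differentiableAt (by simp)
    rw [hd.fderivWithin (uniqueDiffOn_disc z hz), injective_iff_map_eq_zero]
    intro u hu
    have hl := hasDerivAt_line z u
    have hn : HasDerivAt (fun t : ℝ => ‖z + t * u‖ ^ 2) (2 * inner ℝ z u) 0 := by
      simpa using hl.norm_sq
    have h0 : 2 - ‖z + (0 : ℝ) * u‖ ^ 2 ≠ 0 := by simpa using (two_sub_sq_pos hz).ne'
    have h1 := hl.mul ((hn.const_sub 2).sqrt h0).ofReal_comp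
    have h2 := (hn.const_sub 1).ofReal_comp
    have h3 := fderiv_apply_eq_of_line hd (h1.prodMk h2)
    rw [hu] at h3
    -- The second component detects the radial part of a kernel vector. Once this is zero, the first
    -- component is a positive multiple of `u`.
    have h4 : inner ℝ z u = 0 := by
      have := congrArg (fun x : ℂ × ℂ => x.2.re) h3
      simpa using this
    have h5 := congrArg Prod.fst h3
    simp [h4] at h5
    rcases h5 with h5 | h5
    · exact h5
    · exact absurd h5 (Real.sqrt_pos.2 (two_sub_sq_pos hz)).ne'

/-- On the page the second coordinate is a nonnegative real, and over the open disc it is nonzero,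
so its angle `s` is trivial modulo `2π`. -/
theorem pageMap_eq_of_openBookMap_eq {h : ℕ} {s : ℝ} {z w : ℂ} (hz : z ∈ ball (0 : ℂ) 1)
    (hzw : openBookMap h s z = pageMap w) : ∃ k : ℤ, s = k * (2 * Real.pi) := by
  have h1 := congrArg Prod.snd hzw
  simp only [openBookMap, pageMap] at h1
  have hq := Real.sqrt_pos.2 (one_sub_sq_pos hz)
  have h2 := congrArg norm h1
  simp only [norm_mul, norm_exp_mul_I, mul_one, Complex.norm_real, Real.norm_eq_abs,
    abs_of_nonneg (Real.sqrt_nonneg _)] at h2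
  rw [← h2] at h1
  have h3 : Complex.exp (s * Complex.I) = 1 :=
    mul_left_cancel₀ (Complex.ofReal_ne_zero.2 hq.ne') (h1.trans (mul_one _).symm)
  obtain ⟨k, hk⟩ := Complex.exp_eq_one_iff.1 h3
  refine ⟨k, ?_⟩
  have h4 : (s : ℂ) * Complex.I = ((k * (2 * Real.pi) : ℝ) : ℂ) * Complex.I := by
    rw [hk]; push_cast; ring
  exact_mod_cast mul_right_cancel₀ Complex.I_ne_zero h4

theorem differentiableAt_pageMap {z : ℂ} (hz : z ∈ ball (0 : ℂ) 1) :
    DifferentiableAt ℝ pageMap z := by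
  have h1 : DifferentiableAt ℝ (fun w : ℂ => uncurry (openBookMap 0) (0, w)) z :=
    (differentiableAt_openBookMap 0 0 hz).comp z (f := fun w : ℂ => ((0 : ℝ), w))
      ((differentiableAt_const _).prodMk differentiableAt_id)
  simpa only [uncurry, openBookMap_zero] using h1

theorem contDiffOn_pageMap : ContDiffOn ℝ ∞ pageMap (ball 0 1) := by
  intro z hz
  have hn : ContDiffAt ℝ ∞ (fun z : ℂ => ‖z‖ ^ 2) z := contDiffAt_id.norm_sq ℝ
  exact (contDiffAt_id.prodMk (Complex.ofRealCLM.contDiff.contDiffAt.comp z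
    ((contDiffAt_const.sub hn).sqrt (one_sub_sq_pos hz).ne'))).contDiffWithinAt

theorem hasDerivAt_pageMap_comp (h : ℕ) {z : ℝ → ℂ} {t : ℝ} {ζ : ℂ} (hz : HasDerivAt z ζ t)
    (hmem : z t ∈ ball (0 : ℂ) 1) :
    HasDerivAt (fun τ => pageMap (z τ)) (openBookTangent h 0 (z t) (0, ζ)) t := by
  have := hasDerivAt_openBookMap_comp h (hasDerivAt_const t (0 : ℝ)) hz hmem
  simpa only [openBookMap_zero] using this

theorem fderiv_pageMap (h : ℕ) {z : ℂ} (hz : z ∈ ball (0 : ℂ) 1) (u : ℂ) :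
    fderiv ℝ pageMap z u = openBookTangent h 0 z (0, u) := by
  refine fderiv_apply_eq_of_line (differentiableAt_pageMap hz) ?_
  have := hasDerivAt_pageMap_comp h (hasDerivAt_line z u) (by simpa using hz)
  simpa using this

/-- For transversality only the vanishing of the `∂_s`-component matters, so `ζ` is left
unspecified. -/
theorem exists_fderiv_smoothPageMap (h : ℕ) {z : ℂ} (hz : z ∈ ball (0 : ℂ) 1) (u : ℂ) :
    ∃ ζ, fderiv ℝ smoothPageMap z u =
      openBookTangent h 0 (z * (√(2 - ‖z‖ ^ 2) : ℝ)) (0, ζ) := by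
  have hzd : z ∈ disc := ball_subset_closedBall hz
  have hl := hasDerivAt_line z u
  have hn : HasDerivAt (fun t : ℝ => ‖z + t * u‖ ^ 2) (2 * inner ℝ z u) 0 := by
    simpa using hl.norm_sq
  have h0 : 2 - ‖z + (0 : ℝ) * u‖ ^ 2 ≠ 0 := by simpa using (two_sub_sq_pos hzd).ne'
  have h1 := hl.mul ((hn.const_sub 2).sqrt h0).ofReal_comp
  obtain ⟨ζ, hζ⟩ : ∃ ζ, HasDerivAt
      (fun t : ℝ => (z + t * u) * ((√(2 - ‖z + t * u‖ ^ 2) : ℝ) : ℂ)) ζ 0 := ⟨_, h1⟩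
  refine ⟨ζ, fderiv_apply_eq_of_line
    ((contDiffAt_smoothPageMap hzd).differentiableAt (by simp)) ?_⟩
  have h2 := hasDerivAt_pageMap_comp h hζ (by simpa using smooth_reparam_mem_ball hz)
  have h3 : (fun t : ℝ => smoothPageMap (z + t * u)) =ᶠ[nhds 0]
      fun t : ℝ => pageMap ((z + t * u) * ((√(2 - ‖z + t * u‖ ^ 2) : ℝ) : ℂ)) := by
    have hc : ContinuousAt (fun t : ℝ => z + t * u) 0 := hl.continuousAt
    filter_upwards [hc.eventually_mem (isOpen_ball.mem_nhds
      (show z + (0 : ℝ) * u ∈ ball (0 : ℂ) 1 by simpa using hz))] with t ht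
    exact smoothPageMap_eq (ball_subset_closedBall ht)
  simpa using h2.congr_of_eventuallyEq h3

/-! ### The global surface of section and its return map -/

namespace IsLipschitzReebFlow

variable {H : ℝ → ℂ → ℝ} {h : ℕ} {F : ℂ × ℂ → ℝ} {W : ℂ × ℂ → ℂ × ℂ} {K : NNReal}
  {Fl : ℝ → ℂ × ℂ → ℂ × ℂ}

/-- Every orbit off the binding has a lift whose angular coordinate is an increasing bijection. -/
theorem exists_lift_bijective (hFl : IsLipschitzReebFlow F W K Fl) (hF : IsContactCoeff H h F)
    (hH : IsPeriodicHamiltonian H) (hcontact : ContactCondition H) (s₀ : ℝ) {z₀ : ℂ}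
    (hz₀ : z₀ ∈ ball (0 : ℂ) 1) :
    ∃ (s : ℝ → ℝ) (z : ℝ → ℂ), s 0 = s₀ ∧ z 0 = z₀ ∧ StrictMono s ∧ Surjective s ∧
      (∀ t, z t ∈ ball (0 : ℂ) 1) ∧
      (∀ t, Fl t (openBookMap h s₀ z₀) = openBookMap h (s t) (z t)) ∧
      (∀ t, HasDerivAt s (reebDenominator H (s t) (z t))⁻¹ t) ∧
      ∀ t, HasDerivAt z
        ((reebDenominator H (s t) (z t))⁻¹ • hamiltonianField H (s t) (z t)) t := by
  obtain ⟨s, z, hs0, hz0, hall⟩ := hFl.exists_lift hF hH s₀ hz₀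
  obtain ⟨m, M, hm, hmM⟩ := hH.exists_bounds_reebDenominator hcontact
  have hb := fun t => hmM (s t) (z t) (ball_subset_closedBall (hall t).1)
  exact ⟨s, z, hs0, hz0,
    strictMono_of_hasDerivAt_inv_pos (fun t => (hall t).2.2.1) fun t => hm.trans_le (hb t).1,
    surjective_of_hasDerivAt_inv_le (fun t => (hall t).2.2.1) (fun t => hm.trans_le (hb t).1)
      fun t => (hb t).2,
    fun t => (hall t).1, fun t => (hall t).2.1, fun t => (hall t).2.2.1, fun t => (hall t).2.2.2⟩

/-- Off the binding, the angular coordinate along an orbit takes every multiple of `2π`. -/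
theorem exists_time_mem_page (hFl : IsLipschitzReebFlow F W K Fl) (hF : IsContactCoeff H h F)
    (hH : IsPeriodicHamiltonian H) (hcontact : ContactCondition H) {p : ℂ × ℂ}
    (hp : p ∈ sphereThree \ smoothPageMap '' sphere 0 1) :
    (∃ t, 0 < t ∧ Fl t p ∈ smoothPageMap '' ball 0 1) ∧
      ∃ t, t < 0 ∧ Fl t p ∈ smoothPageMap '' ball 0 1 := by
  have hp2 : p.2 ≠ 0 := fun h0 => hp.2 (by
    rw [image_smoothPageMap_sphere]; exact ⟨hp.1, h0⟩)
  obtain ⟨s₀, z₀, hz₀, rfl⟩ := exists_eq_openBookMap h hp.1 hp2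
  obtain ⟨s, z, hs0, -, hmono, hsurj, hzmem, hlift, -⟩ :=
    hFl.exists_lift_bijective hF hH hcontact s₀ hz₀
  have key : ∀ (k : ℤ) (t : ℝ), s t = k * (2 * Real.pi) →
      Fl t (openBookMap h s₀ z₀) ∈ smoothPageMap '' ball 0 1 := by
    intro k t ht
    rw [← image_pageMap_ball, hlift, ht, openBookMap_two_pi_int]
    exact mem_image_of_mem _ (hzmem t)
  constructor
  · obtain ⟨k, hk⟩ := exists_int_gt (s₀ / (2 * Real.pi))
    rw [div_lt_iff₀ Real.two_pi_pos, ← hs0] at hk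
    obtain ⟨t, ht⟩ := hsurj (k * (2 * Real.pi))
    exact ⟨t, hmono.lt_iff_lt.1 (by rwa [ht]), key k t ht⟩
  · obtain ⟨k, hk⟩ := exists_int_lt (s₀ / (2 * Real.pi))
    rw [lt_div_iff₀ Real.two_pi_pos, ← hs0] at hk
    obtain ⟨t, ht⟩ := hsurj (k * (2 * Real.pi))
    exact ⟨t, hmono.lt_iff_lt.1 (by rwa [ht]), key k t ht⟩

theorem isGlobalSurfaceOfSection (hFl : IsLipschitzReebFlow F W K Fl) (hF : IsContactCoeff H h F)
    (hH : IsPeriodicHamiltonian H) (hcontact : ContactCondition H) :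
    IsGlobalSurfaceOfSection (coeffForm F) Fl smoothPageMap where
  embedding := isSmoothDiscEmbedding_smoothPageMap
  boundary_periodic := by
    have hmem : ((1, 0) : ℂ × ℂ) ∈ sphereThree := by simp [sphereThree]
    have horb : ∀ t : ℝ, Fl t (1, 0) = (Complex.exp (t * Complex.I), 0) := by
      intro t
      have h0 := (hFl.flow _ hmem).1
      have := hFl.eq_of_snd_eq_zero hF hmem (t₀ := 0) (by rw [h0]) t
      rw [this, h0]
      simp
    rw [image_smoothPageMap_sphere]
    refine ⟨(1, 0), ⟨hmem, rfl⟩, 2 * Real.pi, Real.two_pi_pos, ?_, ?_⟩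
    · rw [horb]
      push_cast
      rw [Complex.exp_two_pi_mul_I]
    · ext x
      constructor
      · rintro ⟨t, rfl⟩
        exact ⟨((hFl.flow _ hmem).2 t).1, by simp only [horb]⟩
      · rintro ⟨hx, hx2⟩
        have hx' : ‖x.1‖ ^ 2 + ‖x.2‖ ^ 2 = 1 := hx
        have hn : ‖x.1‖ = 1 := by
          rw [hx2, norm_zero] at hx'
          nlinarith [norm_nonneg x.1]
        refine ⟨Complex.arg x.1, ?_⟩
        have := Complex.norm_mul_exp_arg_mul_I x.1
        rw [hn, Complex.ofReal_one, one_mul] at this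
        simp only [horb]
        rw [this, ← hx2]
  transverse z hz v hv := by
    rintro ⟨u, rfl⟩
    have hzd : z ∈ disc := ball_subset_closedBall hz
    rw [((contDiffAt_smoothPageMap hzd).differentiableAt (by simp)).fderivWithin
      (uniqueDiffOn_disc z hzd)] at hv
    obtain ⟨ζ, hζ⟩ := exists_fderiv_smoothPageMap h hz u
    rw [hζ, smoothPageMap_eq hzd, ← openBookMap_zero h] at hv
    -- The `∂_s`-component of the Reeb vector times `H + λ(X)` equals `1`, whereas a vector tangent
    -- to the page has `∂_s`-component zero.
    have := (hF.isReebVector_openBookTangent hH 0 (smooth_reparam_mem_ball hz) hv).1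
    simp at this
  forward p hp := (hFl.exists_time_mem_page hF hH hcontact hp).1
  backward p hp := (hFl.exists_time_mem_page hF hH hcontact hp).2

/-- The first return map of the page is the time-`2π` map of the Hamiltonian isotopy. -/
theorem isFirstReturn (hFl : IsLipschitzReebFlow F W K Fl) (hF : IsContactCoeff H h F)
    (hH : IsPeriodicHamiltonian H) (hcontact : ContactCondition H) {ψ : ℂ → ℂ}
    (hgen : IsGeneratedBy ψ H) {z : ℂ} (hz : z ∈ ball (0 : ℂ) 1) :
    IsFirstReturn Fl (smoothPageMap '' ball 0 1) (pageMap z) (pageMap (ψ z)) := by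
  obtain ⟨φ, hφ0, hφ, hψ⟩ := hgen
  obtain ⟨s, ζ, hs0, hζ0, hmono, hsurj, hζmem, hlift, hsd, hζd⟩ :=
    hFl.exists_lift_bijective hF hH hcontact 0 hz
  rw [openBookMap_zero] at hlift
  obtain ⟨m, M, hm, hmM⟩ := hH.exists_bounds_reebDenominator hcontact
  -- The return time is the moment at which the lifted angle has advanced by exactly `2π`.
  obtain ⟨T, hT⟩ := hsurj (2 * Real.pi)
  have hT0 : 0 < T := hmono.lt_iff_lt.1 (by rw [hs0, hT]; exact Real.two_pi_pos)
  have hζT : ζ T = ψ z := by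
    rw [eq_isotopy_of_hasDerivAt hH hφ0 hφ hs0 hsd hm
      (fun t => (hmM _ _ (ball_subset_closedBall (hζmem t))).1)
      (fun t => ball_subset_closedBall (hζmem t)) hζd hT0.le, hT, hζ0,
      hψ z (ball_subset_closedBall hz)]
  have hFlT : Fl T (pageMap z) = pageMap (ψ z) := by
    have := openBookMap_two_pi_int h 1 (ζ T)
    rw [Int.cast_one, one_mul] at this
    rw [hlift, hT, this, hζT]
  refine ⟨T, hT0, hFlT, ?_, fun t ht hmem => ?_⟩
  · rw [← image_pageMap_ball, ← hζT]
    exact mem_image_of_mem _ (hζmem T)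
  -- An earlier return would put a multiple of `2π` strictly between `0` and `2π`, by monotonicity
  -- of the angle.
  · rw [← image_pageMap_ball, hlift] at hmem
    obtain ⟨w, -, hw⟩ := hmem
    obtain ⟨k, hk⟩ := pageMap_eq_of_openBookMap_eq (hζmem t) hw.symm
    have h1 : 0 < s t := hs0 ▸ hmono ht.1
    have h2 : s t < 2 * Real.pi := hT ▸ hmono ht.2
    rw [hk] at h1 h2
    have h3 : (0 : ℝ) < k := (pos_iff_pos_of_mul_pos h1).2 Real.two_pi_pos
    have h4 : (k : ℝ) < 1 := by
      by_contra! h5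
      nlinarith [Real.two_pi_pos]
    have h5 : (0 : ℤ) < k := by exact_mod_cast h3
    have h6 : k < (1 : ℤ) := by exact_mod_cast h4
    omega

end IsLipschitzReebFlow

end

/-! ### The embedding into the Reeb flow -/

/-- `f` below is the continuous extension over the binding `B × {0}`, `g` the smooth function
whose lift has the same `∞`-jet along `B × {0} × S¹` as the lift of `f`. -/
theorem theorem4p5 (ψ : ℂ → ℂ) (H : ℝ → ℂ → ℝ) (h : ℕ) (ε : ℝ)
    (hψ : IsAreaPreservingDiffeo ψ)
    (hH : IsPeriodicHamiltonian H)
    (hgen : IsGeneratedBy ψ H)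
    (hbdry : ∀ s : ℝ, ∀ z ∈ sphere (0 : ℂ) 1, H s z = h)
    (hcontact : ContactCondition H)
    (hε : 0 < ε) (hε1 : ε ≤ 1)
    (f : ℝ → ℂ → ℝ)
    (hf : ∀ b ϑ : ℝ, ∀ ρ ∈ Ioo 0 (Real.sqrt ε),
      f b ((ρ : ℂ) * Complex.exp ((ϑ : ℂ) * Complex.I)) =
        (uncurry H (bindingMap h b ρ ϑ) - h * (1 - ρ ^ 2) ^ 2) / ρ ^ 2)
    (hfcont : ContinuousOn (uncurry f) (univ ×ˢ ball 0 (Real.sqrt ε)))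
    (hfsmooth : ContDiffOn ℝ ∞ (polarLift f) (polarDomain (Real.sqrt ε)))
    (hfjet : ∃ g : ℝ → ℂ → ℝ,
      (∀ b : ℝ, ∀ w ∈ ball (0 : ℂ) (Real.sqrt ε), g (b + 2 * Real.pi) w = g b w) ∧
      ContDiffOn ℝ ∞ (uncurry g) (univ ×ˢ ball 0 (Real.sqrt ε)) ∧
      ∀ (n : ℕ) (b ϑ : ℝ),
        iteratedFDerivWithin ℝ n (polarLift f) (polarDomain (Real.sqrt ε)) (b, 0, ϑ) =
          iteratedFDerivWithin ℝ n (polarLift g) (polarDomain (Real.sqrt ε)) (b, 0, ϑ)) :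
    EmbedsIntoReebFlow ψ := by
  obtain ⟨F, hF⟩ := exists_isContactCoeff H h hH hbdry hcontact (Real.sqrt_pos.2 hε)
    (Real.sqrt_le_one.2 hε1) f hf hfcont hfsmooth hfjet
  have hα := hF.isContactForm hH hcontact
  obtain ⟨W, K, Fl, hK, hR, hfl⟩ := exists_reebFlow hα
  have hFl : IsLipschitzReebFlow F W K Fl := ⟨hK, hR, hfl⟩
  -- The two parametrisations of the page have different roles: `smoothPageMap` is smooth up to the
  -- boundary, while `pageMap` carries `ω` to `dα` on the interior and is only continuous at the
  -- boundary.
  refine ⟨coeffForm F, Fl, smoothPageMap, pageMap, hα, hFl.isReebFlow,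
    hFl.isGlobalSurfaceOfSection hF hH hcontact, ?_, ?_, image_pageMap_ball, ?_,
    contDiffOn_pageMap, fun z hz => ?_, fun z hz u v => ?_,
    fun z hz => hFl.isFirstReturn hF hH hcontact hgen hz⟩
  · exact (continuous_id.prodMk (Complex.continuous_ofReal.comp
      (continuous_const.sub (continuous_norm.pow 2)).sqrt)).continuousOn
  · exact fun z _ w _ hzw => congrArg Prod.fst hzw
  · exact image_congr fun z hz => by rw [pageMap_of_mem_sphere hz, smoothPageMap_of_mem_sphere hz]
  · rw [injective_iff_map_eq_zero]
    intro u hu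
    rw [fderiv_pageMap 0 hz] at hu
    simpa [openBookTangent] using congrArg Prod.fst hu
  -- Without `∂_s`-components the pulled-back form `dH ∧ ds + ω` reduces to `ω`.
  · rw [fderiv_pageMap h hz, fderiv_pageMap h hz, ← openBookMap_zero h,
      hF.extD_openBookTangent hH 0 hz]
    ring
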